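/- Let $L$ be a first-order language (finitary relation, function and constant symbols) and let $\mathcal{K}$ be a universal class of $L$-structures, i.e. $(\mathcal{K},\subseteq)$ is an abstract elementary class whose strong submodel relation is the substructure relation, and $\mathcal{K}$ is closed under nonempty substructures (equivalently: $\mathcal{K}$ is closed under isomorphisms, nonempty substructures and unions of $\subseteq$-increasing chains). Suppose that $\mathcal{K}$ has arbitrarily large models and that its Löwenheim–Skolem number is $LS(\mathcal{K})=\lambda=|L|+\omega$. Let $\kappa$ be a regular cardinal with $\kappa>\lambda^{+}$ such that $\mathcal{K}$ is $\kappa$-categorical, i.e. has, up to isomorphism, exactly one model of cardinality $\kappa$. Let $\mathcal{K}^{*}$ be the class of all $\mathcal{A}\in\mathcal{K}$ such that $|\mathcal{A}|>\lambda$ and $\mathcal{A}$ embeds into some $\mathcal{B}\in\mathcal{K}$ with $|\mathcal{B}|\ge\kappa$. Then $\mathcal{K}^{*}$ is $\mu$-categorical for every cardinal $\mu$ with $\lambda^{+}<\mu\le\kappa$, i.e. up to isomorphism it has exactly one model of cardinality $\mu$. -/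

import Mathlib

open scoped FirstOrder Cardinal

universe u

namespace UniversalClasses

/-- A class of (small) structures in the language `L`. -/
abbrev ModelClass (L : FirstOrder.Language.{u, u}) := ∀ (M : Type u) [L.Structure M], Prop

variable {L : FirstOrder.Language.{u, u}}

/-- `(K, ⊆)` is a universal class: an abstract elementary class whose strong submodel relation is
the substructure relation and which is closed under substructures. The remaining axioms of an
abstract elementary class (partial order, coherence, smoothness, existence of a Löwenheim-Skolem
number) hold automatically for the substructure relation. Substructures are only required to be in
`K` when they are nonempty, so that both conventions on empty structures are covered. -/
structure IsUniversalClass (K : ModelClass L) : Prop where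
  /-- closed under isomorphism -/
  iso : ∀ (M N : Type u) [L.Structure M] [L.Structure N], (M ≃[L] N) → K M → K N
  /-- closed under substructures -/
  sub : ∀ (M : Type u) [L.Structure M] (A : L.Substructure M), (A : Set M).Nonempty → K M → K A
  /-- closed under unions of (nonempty) chains -/
  chain : ∀ (M : Type u) [L.Structure M] (C : Set (L.Substructure M)), C.Nonempty →
    IsChain (· ≤ ·) C → (∀ A ∈ C, K A) → (∀ x : M, ∃ A ∈ C, x ∈ A) → K M

/-- `K` has arbitrarily large models. -/
def HasArbitrarilyLargeModels (K : ModelClass L) : Prop :=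
  ∀ c : Cardinal.{u}, ∃ (M : Type u) (_ : L.Structure M), K M ∧ c ≤ #M

/-- The Löwenheim-Skolem number of `(K, ⊆)`: the least cardinal `c ≥ |L| + ℵ₀` such that every
subset `A` of a model `M` in `K` is contained in a submodel of `M` in `K` of size at most
`|A| + c`. -/
noncomputable def LS (K : ModelClass L) : Cardinal.{u} :=
  sInf {c | L.card + ℵ₀ ≤ c ∧
    ∀ (M : Type u) [L.Structure M], K M → ∀ A : Set M,
      ∃ S : L.Substructure M, A ⊆ (S : Set M) ∧ K S ∧ #S ≤ #A + c}

/-- `K` is `μ`-categorical: up to isomorphism it has exactly one model of cardinality `μ`. -/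
def IsCategoricalIn (K : ModelClass L) (μ : Cardinal.{u}) : Prop :=
  (∃ (M : Type u) (_ : L.Structure M), K M ∧ #M = μ) ∧
  ∀ (M N : Type u) [L.Structure M] [L.Structure N],
    K M → K N → #M = μ → #N = μ → Nonempty (M ≃[L] N)

/-- The class `K*` of those models in `K` of cardinality greater than `lam` that embed into a model
in `K` of cardinality at least `κ`. -/
def Star (K : ModelClass L) (lam κ : Cardinal.{u}) : ModelClass L :=
  fun (M : Type u) [L.Structure M] =>
    K M ∧ lam < #M ∧
      ∃ (B : Type u) (_ : L.Structure B), K B ∧ κ ≤ #B ∧ Nonempty (M ↪[L] B)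

end UniversalClasses

namespace UniversalClasses

open FirstOrder FirstOrder.Language

universe v w

variable {L : FirstOrder.Language.{u, u}} {K : ModelClass L}

/-! Write λ for |L| + ℵ₀. Only atomic types are needed: the atomic type of a family determines the
substructure it spans up to isomorphism, and membership in `K` is decided on finitely generated
pieces (`mem_of_local`). So a coherent system of finite atomic types realized in members of `K` is
realized in a member of `K` (`exists_realization`). With Erdős–Rado this gives Ehrenfeucht–Mostowski
models over every nonempty linear order (`exists_template`).

Over a well-order such a model realizes few types, so by categoricity every model of size κ is
stable over parameter sets of any size χ ≥ λ. If the order of the indiscernibles mattered, an order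
with many cuts over a small subset would violate this. Hence each model of size κ is generated by κ
totally indiscernible elements, a basis (`exists_isBasis`). Stability also makes a chain of length κ
run out of new types. Its union, and so every model of size κ, realizes over fewer than κ parameters
whatever an extension realizes (`exists_realization_of_embedding`).

The main point is to pass down to a substructure A of size μ of a model M of size κ. A set of more
than χ ≥ λ elements contains infinitely many values of one term at pairwise disjoint tuples of the
basis (`exists_dval`). Such a sequence can be stretched to length κ without changing its type over
small parameter sets. A type over few elements of A that is realized in M is therefore realized in a
stretched model of size κ, and the realization is then pulled back into A
(`exists_realization_mem`).

To compare two such substructures of the same size μ with λ < μ < κ, choose in each a countable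
sequence of one prescribed type, together with κ elements of the ambient model that realize its
average over the substructure (`exists_isAverage`). A type-preserving map between parts of the
substructures that respects the two sequences then extends to an isomorphism between spans of size
κ. Saturation of those spans and of the substructures matches one more element (`exists_extension`),
and a back-and-forth of length μ gives the isomorphism. Models in the starred class of size at most
κ embed into models of size κ, so this settles μ < κ; the case μ = κ is the hypothesis. -/

/-- Atomic formulas of `L` with variables in `V`: equations and relations between terms. -/
abbrev AtForm (L : FirstOrder.Language.{u, u}) (V : Type v) : Type (max u v) :=
  (L.Term V × L.Term V) ⊕ (Σ n, L.Relations n × (Fin n → L.Term V))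

/-- Satisfaction of an atomic formula. -/
def Holds {V : Type v} {M : Type u} [L.Structure M] (x : V → M) : AtForm L V → Prop
  | Sum.inl (t, s) => t.realize x = s.realize x
  | Sum.inr ⟨_, R, ts⟩ => Structure.RelMap R (fun i => (ts i).realize x)

/-- Substitution of terms for the variables of an atomic formula. -/
def AtForm.subst {V : Type v} {V' : Type w} (T : V → L.Term V') : AtForm L V → AtForm L V'
  | Sum.inl (t, s) => Sum.inl (t.subst T, s.subst T)
  | Sum.inr ⟨n, R, ts⟩ => Sum.inr ⟨n, R, fun i => (ts i).subst T⟩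

/-- Renaming of the variables of an atomic formula. -/
def AtForm.relabel {V : Type v} {V' : Type w} (g : V → V') : AtForm L V → AtForm L V'
  | Sum.inl (t, s) => Sum.inl (t.relabel g, s.relabel g)
  | Sum.inr ⟨n, R, ts⟩ => Sum.inr ⟨n, R, fun i => (ts i).relabel g⟩

/-- The atomic type of a family of elements. -/
def atp (L : FirstOrder.Language.{u, u}) {V : Type v} {M : Type u} [L.Structure M] (x : V → M) :
    Set (AtForm L V) :=
  {φ | Holds x φ}

/-! ### Atomic types and their finite character -/

section basics

variable {V : Type v} {V' : Type w} {M N : Type u} [L.Structure M] [L.Structure N]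

theorem holds_relabel (g : V → V') (x : V' → M) (φ : AtForm L V) :
    Holds x (φ.relabel g) ↔ Holds (x ∘ g) φ := by
  rcases φ with ⟨t, s⟩ | ⟨n, R, ts⟩ <;> simp [Holds, AtForm.relabel, Term.realize_relabel]

theorem holds_subst (T : V → L.Term V') (x : V' → M) (φ : AtForm L V) :
    Holds x (φ.subst T) ↔ Holds (fun v => (T v).realize x) φ := by
  rcases φ with ⟨t, s⟩ | ⟨n, R, ts⟩ <;> simp [Holds, AtForm.subst, Term.realize_subst]

theorem relabel_relabel {V'' : Type*} (g : V → V') (h : V' → V'') (φ : AtForm L V) :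
    (φ.relabel g).relabel h = φ.relabel (h ∘ g) := by
  rcases φ with ⟨t, s⟩ | ⟨n, R, ts⟩ <;> simp [AtForm.relabel, Term.relabel_relabel]

theorem holds_iff_of_atp_eq {x : V → M} {y : V → N} (h : atp L x = atp L y) (φ : AtForm L V) :
    Holds x φ ↔ Holds y φ :=
  Set.ext_iff.1 h φ

theorem atp_eq_iff {x : V → M} {y : V → N} :
    atp L x = atp L y ↔ ∀ φ : AtForm L V, Holds x φ ↔ Holds y φ :=
  Set.ext_iff

theorem atp_comp {x : V' → M} {y : V' → N} (h : atp L x = atp L y) (g : V → V') :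
    atp L (x ∘ g) = atp L (y ∘ g) := by
  rw [atp_eq_iff]
  intro φ
  rw [← holds_relabel, ← holds_relabel]
  exact holds_iff_of_atp_eq h _

theorem atp_terms {x : V' → M} {y : V' → N} (h : atp L x = atp L y) (T : V → L.Term V') :
    atp L (fun v => (T v).realize x) = atp L (fun v => (T v).realize y) := by
  rw [atp_eq_iff]
  intro φ
  rw [← holds_subst, ← holds_subst]
  exact holds_iff_of_atp_eq h _

theorem atp_map (e : M ↪[L] N) (x : V → M) : atp L (fun v => e (x v)) = atp L x := by
  have key : ∀ t : L.Term V, t.realize (fun v => e (x v)) = e (t.realize x) := fun t =>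
    HomClass.realize_term (g := e) (v := x)
  rw [atp_eq_iff]
  rintro (⟨t, s⟩ | ⟨n, R, ts⟩)
  · simp only [Holds, key, e.injective.eq_iff]
  · simp only [Holds, key]
    exact e.map_rel R (fun i => (ts i).realize x)

theorem atp_eq_iff_terms {x : V → M} {y : V → N} (h : atp L x = atp L y) (t s : L.Term V) :
    t.realize x = s.realize x ↔ t.realize y = s.realize y :=
  holds_iff_of_atp_eq h (Sum.inl (t, s))

theorem atp_eq_iff_apply {x : V → M} {y : V → N} (h : atp L x = atp L y) (i j : V) :
    x i = x j ↔ y i = y j := by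
  simpa using atp_eq_iff_terms h (Term.var i) (Term.var j)

theorem exists_finset_term (t : L.Term V) :
    ∃ F : Finset V, ∀ S : Set V, ↑F ⊆ S → ∃ t' : L.Term S, t'.relabel Subtype.val = t := by
  classical
  induction t with
  | var i =>
    refine ⟨{i}, fun S hS => ⟨Term.var ⟨i, hS (by simp)⟩, rfl⟩⟩
  | func f ts ih =>
    choose F hF using ih
    refine ⟨Finset.univ.biUnion F, fun S hS => ?_⟩
    have : ∀ i, ∃ t' : L.Term S, t'.relabel Subtype.val = ts i := fun i =>
      hF i S (Set.Subset.trans (by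
        intro a ha
        simp only [Finset.coe_biUnion, Set.mem_iUnion]
        exact ⟨i, by simp, ha⟩) hS)
    choose t' ht' using this
    exact ⟨Term.func f t', by simp [Term.relabel, ht']⟩

theorem exists_finset_atForm (φ : AtForm L V) :
    ∃ F : Finset V, ∀ S : Set V, ↑F ⊆ S → ∃ φ' : AtForm L S, φ'.relabel Subtype.val = φ := by
  classical
  rcases φ with ⟨t, s⟩ | ⟨n, R, ts⟩
  · obtain ⟨F, hF⟩ := exists_finset_term t
    obtain ⟨G, hG⟩ := exists_finset_term s
    refine ⟨F ∪ G, fun S hS => ?_⟩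
    rw [Finset.coe_union, Set.union_subset_iff] at hS
    obtain ⟨t', rfl⟩ := hF S hS.1
    obtain ⟨s', rfl⟩ := hG S hS.2
    exact ⟨Sum.inl (t', s'), rfl⟩
  · choose F hF using fun i => exists_finset_term (ts i)
    refine ⟨Finset.univ.biUnion F, fun S hS => ?_⟩
    have : ∀ i, ∃ t' : L.Term S, t'.relabel Subtype.val = ts i := fun i =>
      hF i S (Set.Subset.trans (by
        intro a ha
        simp only [Finset.coe_biUnion, Set.mem_iUnion]
        exact ⟨i, by simp, ha⟩) hS)
    choose t' ht' using this
    exact ⟨Sum.inr ⟨n, R, t'⟩, by simp [AtForm.relabel, ht']⟩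

/-- Atomic types have finite character. -/
theorem atp_eq_of_finite {x : V → M} {y : V → N}
    (h : ∀ F : Finset V, atp L (fun i : F => x i) = atp L (fun i : F => y i)) :
    atp L x = atp L y := by
  rw [atp_eq_iff]
  intro φ
  obtain ⟨F, hF⟩ := exists_finset_atForm φ
  obtain ⟨φ', rfl⟩ := hF F subset_rfl
  rw [holds_relabel, holds_relabel]
  exact holds_iff_of_atp_eq (h F) φ'

theorem exists_finset_term_realize (t : L.Term V) :
    ∃ (F : Finset V) (t' : L.Term F), t'.relabel Subtype.val = t := by
  obtain ⟨F, hF⟩ := exists_finset_term t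
  obtain ⟨t', h⟩ := hF F subset_rfl
  exact ⟨F, t', h⟩

end basics

/-! ### Substructures generated by a family -/

section generates

variable {V : Type v} {V' : Type w} {M N : Type u} [L.Structure M] [L.Structure N]

/-- The family `x` generates the structure. -/
def Generates (L : FirstOrder.Language.{u, u}) {V : Type v} {M : Type u} [L.Structure M]
    (x : V → M) : Prop :=
  ∀ m : M, ∃ t : L.Term V, t.realize x = m

/-- The substructure of values of terms at the family `x`. -/
def span (L : FirstOrder.Language.{u, u}) {V : Type v} {M : Type u} [L.Structure M]
    (x : V → M) : L.Substructure M where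
  carrier := Set.range (fun t : L.Term V => t.realize x)
  fun_mem := by
    intro n f ys hys
    choose t ht using hys
    exact ⟨Term.func f t, by simp only [Term.realize_func]; congr 1; funext i; exact ht i⟩

theorem realize_mem_span (x : V → M) (t : L.Term V) : t.realize x ∈ span L x := ⟨t, rfl⟩

theorem apply_mem_span (x : V → M) (i : V) : x i ∈ span L x := ⟨Term.var i, rfl⟩

theorem span_le {x : V → M} {S : L.Substructure M} : span L x ≤ S ↔ ∀ i, x i ∈ S := by
  constructor
  · exact fun h i => h (apply_mem_span x i)
  · rintro h _ ⟨t, rfl⟩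
    exact t.realize_mem x h

/-- The generating family of `span L x`. -/
def toSpan (L : FirstOrder.Language.{u, u}) {V : Type v} {M : Type u} [L.Structure M]
    (x : V → M) (i : V) : span L x := ⟨x i, apply_mem_span x i⟩

theorem coe_realize {S : L.Substructure M} (x : V → S) (t : L.Term V) :
    ((t.realize x : S) : M) = t.realize (fun i => (x i : M)) :=
  (HomClass.realize_term (g := S.subtype) (v := x) (t := t)).symm

theorem generates_toSpan (x : V → M) : Generates L (toSpan L x) := by
  rintro ⟨_, t, rfl⟩
  exact ⟨t, Subtype.ext (coe_realize _ _)⟩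

theorem atp_coe {S : L.Substructure M} (x : V → S) : atp L (fun i => (x i : M)) = atp L x :=
  atp_map S.subtype x

theorem atp_toSpan (x : V → M) : atp L (toSpan L x) = atp L x :=
  (atp_coe (toSpan L x)).symm

theorem generates_of_surjective {x : V → M} (h : Function.Surjective x) : Generates L x := by
  intro m
  obtain ⟨i, rfl⟩ := h m
  exact ⟨Term.var i, rfl⟩

/-- Families with equal atomic types that generate their structures yield an isomorphism. -/
theorem exists_equiv_of_atp_eq {x : V → M} {y : V → N} (hx : Generates L x) (hy : Generates L y)
    (h : atp L x = atp L y) :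
    ∃ θ : M ≃[L] N, ∀ t : L.Term V, θ (t.realize x) = t.realize y := by
  choose T hT using hx
  choose T' hT' using hy
  have h1 : ∀ t : L.Term V, (T (t.realize x)).realize y = t.realize y := fun t =>
    (atp_eq_iff_terms h _ _).1 (hT _)
  have h2 : ∀ t : L.Term V, (T' (t.realize y)).realize x = t.realize x := fun t =>
    (atp_eq_iff_terms h _ _).2 (hT' _)
  let e : M ≃ N :=
    { toFun := fun m => (T m).realize y
      invFun := fun n => (T' n).realize x
      left_inv := fun m => by simp only [h2, hT]
      right_inv := fun n => by simp only [h1, hT'] }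
  refine ⟨{ e with
    map_fun' := ?_
    map_rel' := ?_ }, h1⟩
  · intro n f ms
    have := h1 (Term.func f (fun i => T (ms i)))
    simp only [Term.realize_func, hT] at this
    exact this
  · intro n R ms
    have := holds_iff_of_atp_eq h (Sum.inr ⟨n, R, fun i => T (ms i)⟩)
    simp only [Holds, hT] at this
    exact this.symm

theorem exists_equiv_span {x : V → M} {y : V → N} (h : atp L x = atp L y) :
    ∃ θ : span L x ≃[L] span L y, ∀ t : L.Term V,
      (θ ⟨t.realize x, realize_mem_span x t⟩ : N) = t.realize y := by
  obtain ⟨θ, hθ⟩ := exists_equiv_of_atp_eq (generates_toSpan x) (generates_toSpan y)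
    ((atp_toSpan x).trans (h.trans (atp_toSpan y).symm))
  refine ⟨θ, fun t => ?_⟩
  have h1 : (⟨t.realize x, realize_mem_span x t⟩ : span L x) = t.realize (toSpan L x) :=
    Subtype.ext (coe_realize (toSpan L x) t).symm
  rw [h1, hθ, coe_realize]
  rfl

/-- A cardinal bounding the number of symbols and `ℵ₀`. -/
theorem card_term_le (V : Type u) : #(L.Term V) ≤ #V + (L.card + ℵ₀) := by
  refine Term.card_le.trans ?_
  simp only [Cardinal.mk_sum, Cardinal.lift_id]
  have h : #(Σ i, L.Functions i) ≤ L.card := by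
    rw [FirstOrder.Language.card, FirstOrder.Language.Symbols, Cardinal.mk_sum]
    simp
  refine max_le ?_ ?_
  · exact le_trans le_add_self le_add_self
  · gcongr
    exact h.trans le_self_add

theorem card_le_of_generates {V : Type u} {x : V → M} (hx : Generates L x) :
    #M ≤ #V + (L.card + ℵ₀) :=
  le_trans (Cardinal.mk_le_of_surjective (f := fun t : L.Term V => t.realize x) hx)
    (card_term_le V)

theorem card_span_le {V : Type u} (x : V → M) : #(span L x) ≤ #V + (L.card + ℵ₀) :=
  card_le_of_generates (generates_toSpan x)

end generates

/-! ### Locality of membership and compactness for atomic types -/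

/-- A member of the class `K`, bundled with its structure. -/
structure KModel (K : ModelClass L) : Type (u + 1) where
  /-- the universe -/
  carrier : Type u
  /-- the structure -/
  [str : L.Structure carrier]
  /-- membership in the class -/
  mem : K carrier

attribute [instance] KModel.str

instance (K : ModelClass L) : CoeSort (KModel K) (Type u) := ⟨KModel.carrier⟩

theorem IsUniversalClass.span_mem (hK : IsUniversalClass K) {V : Type v} [Nonempty V]
    {M : Type u} [L.Structure M] (hM : K M) (x : V → M) : K (span L x) :=
  hK.sub M _ ⟨x (Classical.arbitrary V), apply_mem_span x _⟩ hM

theorem IsUniversalClass.of_atp_eq (hK : IsUniversalClass K) {V : Type v} [Nonempty V]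
    {M N : Type u} [L.Structure M] [L.Structure N] (hN : K N) {x : V → M} {y : V → N}
    (hx : Generates L x) (h : atp L x = atp L y) : K M := by
  obtain ⟨θ, -⟩ := exists_equiv_of_atp_eq hx (generates_toSpan y) (h.trans (atp_toSpan y).symm)
  exact hK.iso _ _ θ.symm (hK.span_mem hN y)

theorem mk_Iio_lt {c : Cardinal.{u}} (i : c.ord.ToType) : #(Set.Iio i) < c := by
  simpa using Cardinal.mk_Iio_lt i (by simp)

theorem mk_Iic_lt {c : Cardinal.{u}} (hc : ℵ₀ ≤ c) (i : c.ord.ToType) : #(Set.Iic i) < c := by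
  have : NoMaxOrder c.ord.ToType := Cardinal.noMaxOrder hc
  obtain ⟨j, hj⟩ := exists_gt i
  exact lt_of_le_of_lt (Cardinal.mk_le_mk_of_subset fun k hk => lt_of_le_of_lt hk hj)
    (mk_Iio_lt j)

/-- Membership in a universal class is a local property. -/
theorem IsUniversalClass.mem_of_local (hK : IsUniversalClass K) {I : Type u} [Nonempty I]
    {M : Type u} [L.Structure M] {x : I → M} (hx : Generates L x)
    (hloc : ∀ F : Finset I, F.Nonempty → ∃ (N : KModel K) (v : F → N),
      atp L v = atp L (fun i : F => x i)) : K M := by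
  suffices H : ∀ (c : Cardinal.{u}) (I : Type u) (M : Type u) [Nonempty I] [L.Structure M]
      (x : I → M), #I = c → Generates L x → (∀ F : Finset I, F.Nonempty →
      ∃ (N : KModel K) (v : F → N), atp L v = atp L (fun i : F => x i)) → K M from
    H _ I M x rfl hx hloc
  intro c
  induction c using WellFoundedLT.induction with
  | ind c ih =>
  intro I M _ _ x hc hx hloc
  rcases lt_or_ge c ℵ₀ with hfin | hinf
  · have : Finite I := Cardinal.mk_lt_aleph0_iff.1 (hc ▸ hfin)
    have := Fintype.ofFinite I
    obtain ⟨N, v, hv⟩ := hloc Finset.univ Finset.univ_nonempty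
    refine hK.of_atp_eq N.mem hx (y := fun i => v ⟨i, Finset.mem_univ i⟩) ?_
    exact (atp_comp hv (fun i => ⟨i, Finset.mem_univ i⟩)).symm
  -- Well-order the generators in type `c.ord`. Initial segments have fewer than `c` generators, so
  -- their spans lie in `K` by induction, and they form a chain whose union is `M`.
  · obtain ⟨e⟩ : Nonempty (c.ord.ToType ≃ I) := Cardinal.eq.1 (by simp [hc])
    have hmono : ∀ i j : c.ord.ToType, i ≤ j →
        span L (fun k : Set.Iic i => x (e k)) ≤ span L (fun k : Set.Iic j => x (e k)) := by
      intro i j hij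
      rw [span_le]
      rintro ⟨k, hk⟩
      exact apply_mem_span (fun k : Set.Iic j => x (e k)) ⟨k, le_trans hk hij⟩
    refine hK.chain M (Set.range fun i : c.ord.ToType => span L (fun k : Set.Iic i => x (e k)))
      ?_ ?_ ?_ ?_
    · exact ⟨_, e.symm (Classical.arbitrary I), rfl⟩
    · rintro _ ⟨i, rfl⟩ _ ⟨j, rfl⟩ -
      rcases le_total i j with h | h
      · exact Or.inl (hmono i j h)
      · exact Or.inr (hmono j i h)
    · rintro _ ⟨i, rfl⟩
      have : Nonempty (Set.Iic i) := ⟨⟨i, Set.mem_Iic.2 le_rfl⟩⟩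
      refine ih _ (mk_Iic_lt hinf i) (Set.Iic i) _ (toSpan L fun k : Set.Iic i => x (e k)) rfl
        (generates_toSpan _) ?_
      intro F hF
      classical
      let f : Set.Iic i ↪ I := (Function.Embedding.subtype _).trans e.toEmbedding
      have hf : ∀ k : F, f k ∈ F.map f := fun k => Finset.mem_map_of_mem f k.2
      obtain ⟨N, v, hv⟩ := hloc (F.map f) (by simpa using hF)
      refine ⟨N, fun k => v ⟨f k, hf k⟩, ?_⟩
      refine Eq.trans (atp_comp hv (fun k : F => (⟨f k, hf k⟩ : F.map f))) ?_
      exact (atp_comp (atp_toSpan (L := L) fun k : Set.Iic i => x (e k)) (fun k : F => k.1)).symm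
    · intro m
      obtain ⟨t, rfl⟩ := hx m
      obtain ⟨F, t', rfl⟩ := exists_finset_term_realize t
      have : ∃ j : c.ord.ToType, ∀ k ∈ F, e.symm k ≤ j := by
        have : Nonempty c.ord.ToType := ⟨e.symm (Classical.arbitrary I)⟩
        obtain ⟨j, hj⟩ := (F.image e.symm).exists_le
        exact ⟨j, fun k hk => hj _ (Finset.mem_image_of_mem _ hk)⟩
      obtain ⟨j, hj⟩ := this
      refine ⟨_, ⟨j, rfl⟩, ?_⟩
      rw [Term.realize_relabel]
      refine Term.realize_mem _ _ fun a => ?_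
      have := apply_mem_span (L := L) (fun k : Set.Iic j => x (e k)) ⟨e.symm a, hj _ a.2⟩
      simpa using this

/-- A coherent system of finite types that are realized in members of `K` is realized by a
generating family of a member of `K`. -/
theorem IsUniversalClass.exists_realization (hK : IsUniversalClass K) {I : Type u} [Nonempty I]
    (N : Finset I → KModel K) (v : ∀ F, I → N F)
    (hcoh : ∀ F G : Finset I, F ⊆ G → atp L (fun i : F => v F i) = atp L (fun i : F => v G i)) :
    ∃ (M : KModel K) (x : I → M), Generates L x ∧
      ∀ F : Finset I, atp L (fun i : F => x i) = atp L (fun i : F => v F i) := by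
  classical
  -- The ultraproduct need not lie in `K`. It only supplies a structure in which all the prescribed
  -- finite types hold at once; the span of `y` inside it lies in `K` by locality.
  let U : Ultrafilter (Finset I) := Ultrafilter.of Filter.atTop
  have hU : (U : Filter (Finset I)) ≤ Filter.atTop := Ultrafilter.of_le _
  let y : I → (U : Filter (Finset I)).Product (fun F => (N F).carrier) :=
    fun i => ((fun F => v F i : ∀ F, (N F).carrier) : (U : Filter (Finset I)).Product _)
  have hterm : ∀ t : L.Term I, t.realize y =
      ((fun F => t.realize (v F) : ∀ F, (N F).carrier) : (U : Filter (Finset I)).Product _) :=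
    fun t => Ultraproduct.term_realize_cast (fun i F => v F i) t
  have hH : ∀ φ : AtForm L I, Holds y φ ↔ ∀ᶠ F in (U : Filter (Finset I)), Holds (v F) φ := by
    rintro (⟨t, s⟩ | ⟨n, R, ts⟩)
    · simp only [Holds, hterm]
      exact Quotient.eq''
    · simp only [Holds, hterm]
      exact relMap_quotient_mk' (s := (U : Filter (Finset I)).productSetoid _) R
        (fun i F => (ts i).realize (v F))
  have hy : ∀ F : Finset I, atp L (fun i : F => y i) = atp L (fun i : F => v F i) := by
    intro F
    rw [atp_eq_iff]
    intro φ
    have h1 := hH (φ.relabel (Subtype.val : F → I))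
    rw [holds_relabel] at h1
    refine Iff.trans h1 ?_
    have hF : ∀ᶠ G in (U : Filter (Finset I)), F ⊆ G := hU (Filter.eventually_ge_atTop F)
    have h2 : ∀ᶠ G in (U : Filter (Finset I)),
        (Holds (v G) (φ.relabel (Subtype.val : F → I)) ↔ Holds (fun i : F => v F i) φ) := by
      filter_upwards [hF] with G hG
      rw [holds_relabel]
      exact (holds_iff_of_atp_eq (hcoh F G hG) φ).symm
    rw [Filter.eventually_congr h2]
    simp
  have hx : ∀ F : Finset I, atp L (fun i : F => toSpan L y i) = atp L (fun i : F => v F i) :=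
    fun F => (atp_comp (atp_toSpan y) (fun i : F => i.1)).trans (hy F)
  refine ⟨⟨span L y, ?_⟩, toSpan L y, generates_toSpan y, hx⟩
  exact hK.mem_of_local (generates_toSpan y) fun F _ => ⟨N F, fun i => v F i, (hx F).symm⟩

/-! ### Homogeneous sequences for colourings of tuples -/

section ErdosRado

/-- The greedy sequence below `x` whose members have the same colours as `x` over their
predecessors. -/
noncomputable def greedySeq {C W W₂ : Type u} [LinearOrder W] [WellFoundedLT W] [LinearOrder W₂]
    [WellFoundedLT W₂] {n : ℕ} (col : (Fin (n + 1) → W₂) → C) (x : W₂) : W → W₂ :=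
  wellFounded_lt.fix fun w rec =>
    open scoped Classical in
    let τ : W → W₂ := fun v => if h : v < w then rec v h else x
    if h : {y : W₂ | (∀ v < w, τ v < y) ∧ ∀ g : Fin n → W, (∀ i, g i < w) →
      col (Fin.snoc (τ ∘ g) y) = col (Fin.snoc (τ ∘ g) x)}.Nonempty
    then wellFounded_lt.min _ h else x

/-- The candidates for the `w`-th member of the greedy sequence. -/
def greedySet {C W W₂ : Type u} [LinearOrder W] [LinearOrder W₂] {n : ℕ}
    (col : (Fin (n + 1) → W₂) → C) (x : W₂) (τ : W → W₂) (w : W) : Set W₂ :=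
  {y : W₂ | (∀ v < w, τ v < y) ∧ ∀ g : Fin n → W, (∀ i, g i < w) →
      col (Fin.snoc (τ ∘ g) y) = col (Fin.snoc (τ ∘ g) x)}

/-- The candidates at `w` depend only on the earlier terms and on the colours of the target over
them. This removes the default value from the recursion, and it shows that targets with the same
colour pattern have the same greedy sequence. -/
theorem greedySet_congr {C W W₂ : Type u} [LinearOrder W] [LinearOrder W₂] {n : ℕ}
    {col : (Fin (n + 1) → W₂) → C} {x x' : W₂} {τ τ' : W → W₂} {w : W}
    (hτ : ∀ v < w, τ v = τ' v)
    (hx : ∀ g : Fin n → W, (∀ i, g i < w) →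
      col (Fin.snoc (τ ∘ g) x) = col (Fin.snoc (τ' ∘ g) x')) :
    greedySet col x τ w = greedySet col x' τ' w := by
  ext y
  refine and_congr (forall₂_congr fun v hv => by rw [hτ v hv]) ?_
  refine forall₂_congr fun g hg => ?_
  have : τ ∘ g = τ' ∘ g := funext fun i => hτ _ (hg i)
  rw [hx g hg, this]

theorem greedySeq_eq {C W W₂ : Type u} [LinearOrder W] [WellFoundedLT W] [LinearOrder W₂]
    [WellFoundedLT W₂] {n : ℕ} (col : (Fin (n + 1) → W₂) → C) (x : W₂) (w : W)
    (h : (greedySet col x (greedySeq col x) w).Nonempty) :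
    greedySeq col x w = wellFounded_lt.min _ h := by
  classical
  have key : greedySet col x (fun v : W => if v < w then greedySeq col x v else x) w =
      greedySet col x (greedySeq col x) w := by
    refine greedySet_congr (fun v hv => if_pos hv) fun g hg => ?_
    congr 2
    funext i
    exact if_pos (hg i)
  conv_lhs => rw [greedySeq, WellFounded.fix_eq]
  change (if h' : (greedySet col x (fun v : W => if v < w then greedySeq col x v else x) w).Nonempty
    then wellFounded_lt.min _ h' else x) = _
  simp only [key]
  rw [dif_pos h]

/-- Every colouring of the `(n+1)`-tuples of a sufficiently long well-order has an end-homogeneous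
subset of a given order type. -/
theorem exists_endHomogeneous (n : ℕ) (C W : Type u) [LinearOrder W] [WellFoundedLT W] :
    ∃ (W₂ : Type u) (_ : LinearOrder W₂) (_ : WellFoundedLT W₂), ∀ col : (Fin (n + 1) → W₂) → C,
      ∃ (a : W → W₂) (x : W₂), StrictMono a ∧ ∀ (g : Fin n → W) (w : W), (∀ i, g i < w) →
        col (Fin.snoc (a ∘ g) (a w)) = col (Fin.snoc (a ∘ g) x) := by
  -- The length exceeds the number of pairs consisting of a stopping stage and a colour pattern.
  refine ⟨(Order.succ #(W × ((Fin n → W) → C))).ord.ToType, inferInstance, inferInstance,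
    fun col => ?_⟩
  by_contra hcon
  push Not at hcon
  have hself : ∀ x (w : W), (∀ v < w, greedySeq col x v < x) →
      x ∈ greedySet col x (greedySeq col x) w := fun x w h => ⟨h, fun _ _ => rfl⟩
  have hmem : ∀ x (w : W), (∀ v < w, greedySeq col x v < x) →
      greedySeq col x w ∈ greedySet col x (greedySeq col x) w := by
    intro x w h
    have hne : (greedySet col x (greedySeq col x) w).Nonempty := ⟨x, hself x w h⟩
    rw [greedySeq_eq col x w hne]
    exact wellFounded_lt.min_mem _ hne
  have hle : ∀ x (w : W), (∀ v < w, greedySeq col x v < x) → greedySeq col x w ≤ x := by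
    intro x w h
    have hne : (greedySet col x (greedySeq col x) w).Nonempty := ⟨x, hself x w h⟩
    rw [greedySeq_eq col x w hne]
    exact wellFounded_lt.min_le (hself x w h)
  -- A greedy sequence that stays below its target `x` forever would be end-homogeneous with end
  -- point `x`. So it must hit `x`.
  have hex : ∀ x, ∃ w : W, greedySeq col x w = x ∧ ∀ v < w, greedySeq col x v < x := by
    intro x
    have h1 : ∃ w : W, ¬ greedySeq col x w < x := by
      by_contra h
      push Not at h
      obtain ⟨g, w, hg, hne⟩ := hcon (greedySeq col x) x
        (fun v w hvw => (hmem x w fun v _ => h v).1 v hvw)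
      exact hne ((hmem x w fun v _ => h v).2 g hg)
    obtain ⟨w, hw, hmin⟩ := wellFounded_lt.has_min {w : W | ¬ greedySeq col x w < x} h1
    have h2 : ∀ v < w, greedySeq col x v < x := fun v hv => by
      by_contra h
      exact hmin v h hv
    exact ⟨w, le_antisymm (hle x w h2) (not_lt.1 hw), h2⟩
  choose w hw hlt using hex
  -- The pattern determines the greedy sequence up to the stage where it reaches `x`, so pattern and
  -- stage together determine `x`.
  have hinj : Function.Injective fun x =>
      (w x, fun g : Fin n → W => col (Fin.snoc (greedySeq col x ∘ g) x)) := by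
    intro x x' hxx'
    obtain ⟨hw', hψ⟩ := Prod.mk.inj hxx'
    have key : ∀ v : W, v ≤ w x → greedySeq col x v = greedySeq col x' v := by
      intro v
      induction v using WellFoundedLT.induction with
      | ind v ih =>
      intro hv
      have e : greedySet col x (greedySeq col x) v = greedySet col x' (greedySeq col x') v :=
        greedySet_congr (fun u hu => ih u hu (hu.le.trans hv)) fun g _ => congrFun hψ g
      have h1 : (greedySet col x (greedySeq col x) v).Nonempty :=
        ⟨x, hself x v fun u hu => hlt x u (hu.trans_le hv)⟩
      rw [greedySeq_eq col x v h1, greedySeq_eq col x' v (e ▸ h1)]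
      simp only [e]
    rw [← hw x, key _ le_rfl, hw', hw x']
  have := Cardinal.mk_le_of_injective hinj
  rw [Cardinal.mk_ord_toType] at this
  exact absurd this (not_le.2 (Order.lt_succ _))

/-- A form of the Erdős–Rado theorem. -/
theorem exists_homogeneous (C : Type u) (n : ℕ) : ∀ (W : Type u) [LinearOrder W] [WellFoundedLT W],
    ∃ (W₁ : Type u) (_ : LinearOrder W₁) (_ : WellFoundedLT W₁), ∀ col : (Fin n → W₁) → C,
      ∃ a : W → W₁, StrictMono a ∧ ∃ k, ∀ g : Fin n → W, StrictMono g → col (a ∘ g) = k := by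
  induction n with
  | zero =>
    intro W _ _
    refine ⟨W, inferInstance, inferInstance, fun col => ⟨id, strictMono_id, col Fin.elim0, ?_⟩⟩
    intro g _
    congr 1
    exact Subsingleton.elim _ _
  | succ n ih =>
    intro W _ _
    obtain ⟨W₁, _, _, h₁⟩ := ih W
    obtain ⟨W₂, i1, i2, h₂⟩ := exists_endHomogeneous n C W₁
    refine ⟨W₂, i1, i2, fun col => ?_⟩
    obtain ⟨a, x, ha, hax⟩ := h₂ col
    -- Replacing the last coordinate by the end point `x` turns the colouring of (n+1)-tuples into
    -- one of n-tuples.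
    obtain ⟨b, hb, k, hk⟩ := h₁ fun g => col (Fin.snoc (a ∘ g) x)
    refine ⟨a ∘ b, ha.comp hb, k, fun g hg => ?_⟩
    have h3 := hax (b ∘ Fin.init g) (b (g (Fin.last n)))
      (fun i => hb (hg (Fin.castSucc_lt_last i)))
    have h4 := hk (Fin.init g) (fun i j hij => hg (Fin.castSucc_lt_castSucc_iff.2 hij))
    rw [← h4, ← h3]
    congr 1
    funext i
    refine Fin.lastCases ?_ (fun j => ?_) i
    · simp
    · simp [Fin.init]

end ErdosRado

/-! ### Ehrenfeucht–Mostowski templates -/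

section Template

/-- Properties of linearly ordered families of elements of members of `K`. -/
abbrev SeqProp (K : ModelClass L) : Type (u + 1) :=
  ∀ (W : Type u) [LinearOrder W] (N : KModel K), (W → N) → Prop

/-- The property passes to subfamilies and is satisfied by arbitrarily long well-ordered
families. -/
structure SeqProp.IsLarge (P : SeqProp K) : Prop where
  comp : ∀ (W W' : Type u) [LinearOrder W] [LinearOrder W'] (N : KModel K) (a : W' → N)
    (f : W → W'), StrictMono f → P W' N a → P W N (a ∘ f)
  exists_seq : ∀ (W : Type u) [LinearOrder W] [WellFoundedLT W], ∃ (N : KModel K) (a : W → N),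
    P W N a

/-- All increasing `n`-tuples of the family have the atomic type `Φ`. -/
def SeqProp.homog {n : ℕ} (Φ : Set (AtForm L (Fin n))) : SeqProp K :=
  fun W _ _ a => ∀ g : Fin n → W, StrictMono g → atp L (a ∘ g) = Φ

/-- If every candidate type failed at some length, a homogeneous sequence as long as the supremum of
these lengths would have some type `Φ` and restrict to the length at which `Φ` fails. -/
theorem SeqProp.IsLarge.exists_homog {P : SeqProp K} (hP : P.IsLarge) (n : ℕ) :
    ∃ Φ : Set (AtForm L (Fin n)),
      SeqProp.IsLarge (K := K) fun W _ N a => P W N a ∧ SeqProp.homog Φ W N a := by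
  have hcomp : ∀ Φ : Set (AtForm L (Fin n)), ∀ (W W' : Type u) [LinearOrder W] [LinearOrder W']
      (N : KModel K) (a : W' → N) (f : W → W'), StrictMono f →
      (P W' N a ∧ SeqProp.homog Φ W' N a) → (P W N (a ∘ f) ∧ SeqProp.homog Φ W N (a ∘ f)) := by
    intro Φ W W' _ _ N a f hf h
    exact ⟨hP.comp W W' N a f hf h.1, fun g hg => h.2 (f ∘ g) (hf.comp hg)⟩
  by_contra hcon
  push Not at hcon
  have h1 : ∀ Φ : Set (AtForm L (Fin n)), ∃ (W : Type u) (_ : LinearOrder W) (_ : WellFoundedLT W),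
      ∀ (N : KModel K) (a : W → N), ¬ (P W N a ∧ SeqProp.homog Φ W N a) := by
    intro Φ
    by_contra h
    push Not at h
    exact hcon Φ ⟨hcomp Φ, fun W i1 i2 => h W i1 i2⟩
  choose W i1 i2 hW using h1
  let o : Ordinal.{u} := ⨆ Φ, Ordinal.type (α := W Φ) (· < ·)
  obtain ⟨W₁, _, _, h₁⟩ := exists_homogeneous (Set (AtForm L (Fin n))) n o.ToType
  obtain ⟨N, a, ha⟩ := hP.exists_seq W₁
  obtain ⟨b, hb, Φ, hΦ⟩ := h₁ fun g => atp L (a ∘ g)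
  have hle : Ordinal.type (α := W Φ) (· < ·) ≤ Ordinal.type (α := o.ToType) (· < ·) := by
    rw [Ordinal.type_toType]
    exact Ordinal.le_iSup (fun Φ => Ordinal.type (α := W Φ) (· < ·)) Φ
  obtain ⟨f⟩ := Ordinal.type_le_iff.1 hle
  have hf : StrictMono f := fun _ _ h => f.map_rel_iff.2 h
  refine hW Φ N ((a ∘ b) ∘ f) ?_
  exact hcomp Φ _ _ _ _ _ hf ⟨hP.comp _ _ _ _ _ hb ha, fun g hg => hΦ g hg⟩

/-- The first `n` steps in the construction of a template. -/
noncomputable def templateStage {P : SeqProp K} (hP : P.IsLarge) :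
    ℕ → {Q : SeqProp K // Q.IsLarge}
  | 0 => ⟨P, hP⟩
  | n + 1 => ⟨_, ((templateStage hP n).2.exists_homog n).choose_spec⟩

/-- The types are fixed once for all arities, but the sequences may change with `n`. Homogeneity for
finitely many arities at a time is all that compactness requires. -/
theorem exists_homog_seq {P : SeqProp K} (hP : P.IsLarge) :
    ∃ Φ : ∀ n, Set (AtForm L (Fin n)), ∀ (n : ℕ) (W : Type u) [LinearOrder W] [WellFoundedLT W],
      ∃ (N : KModel K) (a : W → N), P W N a ∧ ∀ k < n, SeqProp.homog (Φ k) W N a := by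
  let Φ : ∀ n, Set (AtForm L (Fin n)) := fun n =>
    ((templateStage hP n).2.exists_homog n).choose
  have key : ∀ (n : ℕ) (W : Type u) [LinearOrder W] (N : KModel K) (a : W → N),
      (templateStage hP n).1 W N a → P W N a ∧ ∀ k < n, SeqProp.homog (Φ k) W N a := by
    intro n
    induction n with
    | zero => exact fun W _ N a h => ⟨h, fun k hk => absurd hk (Nat.not_lt_zero k)⟩
    | succ n ih =>
      intro W _ N a h
      have h' : (templateStage hP n).1 W N a ∧ SeqProp.homog (Φ n) W N a := h
      refine ⟨(ih W N a h'.1).1, fun k hk => ?_⟩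
      rcases Nat.lt_succ_iff_lt_or_eq.1 hk with hk | rfl
      · exact (ih W N a h'.1).2 k hk
      · exact h'.2
  refine ⟨Φ, fun n W _ _ => ?_⟩
  obtain ⟨N, a, h⟩ := (templateStage hP n).2.exists_seq W
  exact ⟨N, a, key n W N a h⟩

/-- Order-indiscernible generating families along all linear orders. -/
theorem IsUniversalClass.exists_template (hK : IsUniversalClass K)
    (hlarge : HasArbitrarilyLargeModels K) :
    ∃ Φ : ∀ n, Set (AtForm L (Fin n)), ∀ (I : Type u) [LinearOrder I] [Nonempty I],
      ∃ (M : KModel K) (x : I → M), Generates L x ∧ Function.Injective x ∧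
        ∀ (n : ℕ) (g : Fin n → I), StrictMono g → atp L (x ∘ g) = Φ n := by
  classical
  have hP : SeqProp.IsLarge (K := K) fun W _ N a => Function.Injective a := by
    refine ⟨fun W W' _ _ N a f hf h => h.comp hf.injective, fun W _ _ => ?_⟩
    obtain ⟨M, _, hM, hc⟩ := hlarge #W
    obtain ⟨f⟩ := Cardinal.le_def _ _ |>.1 hc
    exact ⟨⟨M, hM⟩, f, f.injective⟩
  obtain ⟨Φ, hΦ⟩ := exists_homog_seq hP
  refine ⟨Φ, fun I _ _ => ?_⟩
  have h1 : ∀ F : Finset I, ∃ (N : KModel K) (v : I → N), Set.InjOn v F ∧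
      ∀ (n : ℕ) (g : Fin n → I), StrictMono g → (∀ i, g i ∈ F) → atp L (v ∘ g) = Φ n := by
    intro F
    obtain ⟨N, a, ha, hh⟩ := hΦ (F.card + 1) (ULift.{u} (Fin (F.card + 1)))
    -- The last of the `F.card + 1` places receives the indices outside `F`; the others carry `F` in
    -- increasing order.
    let r : I → ULift.{u} (Fin (F.card + 1)) := fun i => if h : i ∈ F then
      ⟨((F.orderIsoOfFin rfl).symm ⟨i, h⟩).castSucc⟩ else ⟨Fin.last _⟩
    have hr : ∀ i ∈ F, ∀ j ∈ F, i < j → r i < r j := by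
      intro i hi j hj hij
      simp only [r, dif_pos hi, dif_pos hj, ← ULift.down_lt, Fin.castSucc_lt_castSucc_iff]
      exact (F.orderIsoOfFin rfl).symm.strictMono (show (⟨i, hi⟩ : F) < ⟨j, hj⟩ from hij)
    have hinj : Set.InjOn r F := by
      intro i hi j hj hij
      rcases lt_trichotomy i j with h | h | h
      · exact absurd hij (hr i hi j hj h).ne
      · exact h
      · exact absurd hij (hr j hj i hi h).ne'
    refine ⟨N, a ∘ r, ha.comp_injOn hinj, fun n g hg hgF => ?_⟩
    have hn : n ≤ F.card := by
      have := Finset.card_le_card_of_injOn (s := Finset.univ) (t := F) g (fun i _ => hgF i)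
        hg.injective.injOn
      simpa using this
    exact hh n (Nat.lt_succ_of_le hn) (r ∘ g) fun i j hij => hr _ (hgF i) _ (hgF j) (hg hij)
  choose N v hv1 hv2 using h1
  have hsub : ∀ F G : Finset I, F ⊆ G →
      atp L (fun i : F => v F i) = atp L (fun i : F => v G i) := by
    intro F G hFG
    have e := F.orderIsoOfFin rfl
    have hm : StrictMono fun i => (e i : I) := fun i j hij => e.strictMono hij
    have h2 : atp L (v F ∘ fun i => (e i : I)) = atp L (v G ∘ fun i => (e i : I)) :=
      (hv2 F _ _ hm fun i => (e i).2).trans (hv2 G _ _ hm fun i => hFG (e i).2).symm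
    have h3 := atp_comp h2 e.symm
    simpa [Function.comp_def] using h3
  obtain ⟨M, x, hx, hxF⟩ := hK.exists_realization N v hsub
  refine ⟨M, x, hx, ?_, ?_⟩
  · intro i j hij
    have h4 := atp_eq_iff_apply (hxF {i, j}) ⟨i, by simp⟩ ⟨j, by simp⟩
    exact hv1 {i, j} (by simp) (by simp) (h4.1 hij)
  · intro n g hg
    have h5 := atp_comp (hxF (Finset.univ.image g))
      (fun i : Fin n => ⟨g i, Finset.mem_image_of_mem _ (Finset.mem_univ i)⟩)
    exact h5.trans (hv2 _ n g hg fun i => Finset.mem_image_of_mem _ (Finset.mem_univ i))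

end Template

/-! ### Cardinal estimates -/

section Cardinals

variable {χ : Cardinal.{u}}

theorem mk_fin_fun_le (hχ : ℵ₀ ≤ χ) {α : Type u} (h : #α ≤ χ) (n : ℕ) : #(Fin n → α) ≤ χ := by
  have : #(Fin n → α) = #α ^ n := by simp
  rw [this]
  exact (Cardinal.power_le_power_right h).trans (Cardinal.power_nat_le hχ)

theorem mk_prod_le (hχ : ℵ₀ ≤ χ) {α β : Type u} (h : #α ≤ χ) (h' : #β ≤ χ) : #(α × β) ≤ χ := by
  have : #(α × β) = #α * #β := by simp
  rw [this]
  exact (mul_le_mul' h h').trans (Cardinal.mul_eq_self hχ).le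

theorem mk_sum_le (hχ : ℵ₀ ≤ χ) {α β : Type u} (h : #α ≤ χ) (h' : #β ≤ χ) : #(α ⊕ β) ≤ χ := by
  have : #(α ⊕ β) = #α + #β := by simp
  rw [this]
  exact (add_le_add h h').trans (Cardinal.add_eq_self hχ).le

theorem mk_sigma_le (hχ : ℵ₀ ≤ χ) {ι : Type u} {α : ι → Type u} (hι : #ι ≤ χ)
    (h : ∀ i, #(α i) ≤ χ) : #(Σ i, α i) ≤ χ := by
  rw [Cardinal.mk_sigma]
  exact (Cardinal.sum_le_mk_mul_iSup _).trans ((mul_le_mul' hι (ciSup_le' h)).trans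
    (Cardinal.mul_eq_self hχ).le)

theorem mk_iUnion_le' (hχ : ℵ₀ ≤ χ) {ι α : Type u} {s : ι → Set α} (hι : #ι ≤ χ)
    (h : ∀ i, #(s i) ≤ χ) : #(⋃ i, s i) ≤ χ :=
  (Cardinal.mk_iUnion_le _).trans ((mul_le_mul' hι (ciSup_le' h)).trans
    (Cardinal.mul_eq_self hχ).le)

theorem mk_sigma_nat_le (hχ : ℵ₀ ≤ χ) {α : ℕ → Type u} (h : ∀ i, #(α i) ≤ χ) :
    #(Σ i, α i) ≤ χ := by
  have e : (Σ i : ULift.{u} ℕ, α i.down) ≃ (Σ i, α i) :=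
    Equiv.sigmaCongrLeft (β := α) Equiv.ulift
  rw [← Cardinal.mk_congr e]
  exact mk_sigma_le hχ (by simpa using hχ) fun i => h _

theorem mk_option_le (hχ : ℵ₀ ≤ χ) {α : Type u} (h : #α ≤ χ) : #(Option α) ≤ χ := by
  rw [Cardinal.mk_option]
  exact (add_le_add h (Cardinal.one_le_aleph0.trans hχ)).trans (Cardinal.add_eq_self hχ).le

theorem mk_finite_le (hχ : ℵ₀ ≤ χ) (α : Type u) [Finite α] : #α ≤ χ :=
  (Cardinal.mk_lt_aleph0_iff.2 inferInstance).le.trans hχ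

theorem mk_term_le_of_le {V : Type u} (hχ : L.card + ℵ₀ ≤ χ) (h : #V ≤ χ) : #(L.Term V) ≤ χ :=
  (card_term_le V).trans ((add_le_add h hχ).trans
    (Cardinal.add_eq_self (le_trans le_add_self hχ)).le)

theorem mk_term_fin_le (hχ : L.card + ℵ₀ ≤ χ) (m : ℕ) : #(L.Term (Fin m)) ≤ χ := by
  have e : L.Term (ULift.{u} (Fin m)) ≃ L.Term (Fin m) := Term.relabelEquiv Equiv.ulift
  rw [← Cardinal.mk_congr e]
  exact mk_term_le_of_le hχ (mk_finite_le (le_trans le_add_self hχ) _)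

/-- Used to count types: each tuple is described by some datum in `D`, and the datum determines the
type. -/
theorem mk_range_le_of_data {α T : Type u} {D : Type u} (f : α → T) (R : α → D → Prop)
    (hR : ∀ a, ∃ d, R a d) (h : ∀ a a' d, R a d → R a' d → f a = f a') : #(Set.range f) ≤ #D := by
  choose d hd using hR
  refine Cardinal.mk_le_of_injective (f := fun y : Set.range f => d y.2.choose) ?_
  intro y y' hyy'
  refine Subtype.ext ?_
  rw [← y.2.choose_spec, ← y'.2.choose_spec]
  have h1 := hd y'.2.choose
  have h2 : d y.2.choose = d y'.2.choose := hyy'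
  rw [← h2] at h1
  exact h _ _ _ (hd _) h1

end Cardinals

/-! ### Finite and small supports of elements -/

section supports

variable {M : Type u} [L.Structure M]

/-- Finitely many values of terms are values of terms over one finite subfamily. -/
theorem exists_common_support {I : Type*} {x : I → M} {n : ℕ} (c : Fin n → M)
    (hc : ∀ k, c k ∈ span L x) :
    ∃ (m : ℕ) (g : Fin m → I) (t : Fin n → L.Term (Fin m)), Function.Injective g ∧
      ∀ k, c k = (t k).realize (x ∘ g) := by
  classical
  choose t ht using hc
  have ht : ∀ k, (t k).realize x = c k := ht
  choose F hF using fun k => exists_finset_term (t k)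
  let G : Finset I := Finset.univ.biUnion F
  have hG : ∀ k, ∃ t' : L.Term G, t'.relabel Subtype.val = t k := fun k => by
    obtain ⟨t', h⟩ := hF k G (Finset.coe_subset.2 (Finset.subset_biUnion_of_mem F
      (Finset.mem_univ k)))
    exact ⟨t', h⟩
  choose t' ht' using hG
  refine ⟨G.card, fun i => G.equivFin.symm i, fun k => (t' k).relabel G.equivFin, ?_, fun k => ?_⟩
  · exact Subtype.val_injective.comp G.equivFin.symm.injective
  · rw [Term.realize_relabel, ← ht k, ← ht' k, Term.realize_relabel]
    congr 1
    funext i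
    simp

/-- A small family in the span of `x` is in the span of a small subfamily of `x`. -/
theorem exists_small_support {I β : Type u} {x : I → M} (b : β → M) (hb : ∀ p, b p ∈ span L x)
    {χ : Cardinal.{u}} (hχ : ℵ₀ ≤ χ) (hβ : #β ≤ χ) :
    ∃ (S : Set I) (T : β → L.Term S), #S ≤ χ ∧ ∀ p, b p = (T p).realize (fun s : S => x s) := by
  choose t ht using hb
  have ht : ∀ k, (t k).realize x = b k := ht
  choose F hF using fun k => exists_finset_term (t k)
  choose T hT using fun k => hF k (⋃ k, (F k : Set I)) (Set.subset_iUnion (fun k => (F k : Set I)) k)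
  refine ⟨⋃ k, (F k : Set I), T, mk_iUnion_le' hχ hβ fun k => mk_finite_le hχ _, fun p => ?_⟩
  rw [← ht p, ← hT p, Term.realize_relabel]
  rfl

end supports

/-! ### Stability of models generated by well-ordered indiscernibles -/

section stability

variable {M : Type u} [L.Structure M]

/-- The family `x` is order-indiscernible with template `Φ`. -/
def HasTemplate {I : Type u} [LinearOrder I] (Φ : ∀ n, Set (AtForm L (Fin n))) (x : I → M) : Prop :=
  ∀ (n : ℕ) (g : Fin n → I), StrictMono g → atp L (x ∘ g) = Φ n

/-- By finite character it suffices to list finitely many indices increasingly. The order pattern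
makes the corresponding list on the other side increasing too, and it carries ties to ties. -/
theorem HasTemplate.atp_eq {I : Type u} [LinearOrder I] {Φ : ∀ n, Set (AtForm L (Fin n))}
    {x : I → M} (h : HasTemplate Φ x) {P : Type u} {g g' : P → I}
    (hgg : ∀ p q, g p ≤ g q ↔ g' p ≤ g' q) : atp L (x ∘ g) = atp L (x ∘ g') := by
  classical
  refine atp_eq_of_finite fun F => ?_
  let S : Finset I := F.image g
  let e := S.orderIsoOfFin rfl
  have hs : ∀ i, ∃ p ∈ F, g p = e i := fun i => by
    simpa only [Finset.mem_image] using Finset.mem_image.1 (e i).2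
  choose p hpF hp using hs
  have hm : StrictMono fun i => (e i : I) := fun i j hij => e.strictMono hij
  have hm' : StrictMono fun i => g' (p i) := by
    intro i j hij
    have h1 := hm hij
    simp only [← hp] at h1
    exact lt_of_not_ge fun h2 => absurd ((hgg _ _).2 h2) (not_le.2 h1)
  have h1 := (h _ _ hm).trans (h _ _ hm').symm
  have hmem : ∀ q : F, g q ∈ S := fun q => Finset.mem_image_of_mem g q.2
  have h2 := atp_comp h1 (fun q : F => e.symm ⟨g q, hmem q⟩)
  have e1 : (x ∘ fun i => (e i : I)) ∘ (fun q : F => e.symm ⟨g q, hmem q⟩) =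
      fun q : F => (x ∘ g) q := by
    funext q; simp
  have e2 : (x ∘ fun i => g' (p i)) ∘ (fun q : F => e.symm ⟨g q, hmem q⟩) =
      fun q : F => (x ∘ g') q := by
    funext q
    have h3 : g (p (e.symm ⟨g q, hmem q⟩)) = g q := by rw [hp]; simp
    have h4 : g' (p (e.symm ⟨g q, hmem q⟩)) = g' q :=
      le_antisymm ((hgg _ _).1 h3.le) ((hgg _ _).1 h3.ge)
    simp [h4]
  rw [e1, e2] at h2
  exact h2

/-- The least element of a set in a well-order, if there is one. -/
noncomputable def minOpt {S : Type u} [LinearOrder S] [WellFoundedLT S] (A : Set S) : Option S :=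
  open scoped Classical in
  if h : A.Nonempty then some (wellFounded_lt.min A h) else none

/-- In a well-order an upper set is coded by its least element, so a cut in `S` takes few values. An
arbitrary linear order could have many more cuts. -/
theorem mem_iff_minOpt {S : Type u} [LinearOrder S] [WellFoundedLT S] {A : Set S}
    (hA : IsUpperSet A) (s : S) : s ∈ A ↔ ∃ s₀ ∈ minOpt A, s₀ ≤ s := by
  unfold minOpt
  split_ifs with h
  · simp only [Option.mem_def, Option.some.injEq, exists_eq_left']
    exact ⟨fun hs => wellFounded_lt.min_le hs, fun hs => hA hs (wellFounded_lt.min_mem A h)⟩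
  · simp only [Option.mem_def, reduceCtorEq, false_and, exists_false, iff_false]
    exact fun hs => h ⟨s, hs⟩

/-- Stability: few types are realized over a small family in a structure generated by
well-ordered indiscernibles. -/
theorem HasTemplate.mk_types_le {W : Type u} [LinearOrder W] [WellFoundedLT W]
    {Φ : ∀ n, Set (AtForm L (Fin n))} {x : W → M} (h : HasTemplate Φ x) (hx : Generates L x)
    {χ : Cardinal.{u}} (hχ : L.card + ℵ₀ ≤ χ) {β : Type u} (b : β → M) (hβ : #β ≤ χ) (n : ℕ) :
    #(Set.range fun c : Fin n → M => atp L (Sum.elim b c)) ≤ χ := by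
  have hχ₀ : ℵ₀ ≤ χ := le_trans le_add_self hχ
  obtain ⟨S, T, hS, hT⟩ := exists_small_support (x := x) b (fun p => hx _) hχ₀ hβ
  -- A tuple is coded by its terms, the order pattern of their indices, and the cut of each index in
  -- the support `S` of `b`. The two options record the least element of `S` weakly above and
  -- strictly above the index.
  let D := Σ m : ℕ, (Fin n → L.Term (Fin m)) × (Fin m → Fin m → ULift.{u} Prop) ×
    (Fin m → Option S × Option S)
  have hD : #D ≤ χ := by
    refine mk_sigma_nat_le hχ₀ fun m => mk_prod_le hχ₀ ?_ (mk_prod_le hχ₀ ?_ ?_)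
    · exact mk_fin_fun_le hχ₀ (mk_term_fin_le hχ m) _
    · exact mk_finite_le hχ₀ _
    · exact mk_fin_fun_le hχ₀ (mk_prod_le hχ₀ (mk_option_le hχ₀ hS) (mk_option_le hχ₀ hS)) _
  refine le_trans (mk_range_le_of_data (D := D) _ (fun c d => ∃ g : Fin d.1 → W,
    (∀ k, c k = (d.2.1 k).realize (x ∘ g)) ∧ (∀ i j, g i ≤ g j ↔ (d.2.2.1 i j).down) ∧
    ∀ i, d.2.2.2 i = (minOpt {s : S | g i ≤ s}, minOpt {s : S | g i < s})) ?_ ?_) hD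
  · intro c
    obtain ⟨m, g, t, -, ht⟩ := exists_common_support (x := x) c (fun k => hx _)
    exact ⟨⟨m, t, fun i j => ⟨g i ≤ g j⟩, fun i => (minOpt {s : S | g i ≤ s},
      minOpt {s : S | g i < s})⟩, g, ht, fun _ _ => Iff.rfl, fun _ => rfl⟩
  · rintro c c' ⟨m, t, r, d⟩ ⟨g, hg1, hg2, hg3⟩ ⟨g', hg1', hg2', hg3'⟩
    dsimp only at g g' hg1 hg2 hg3 hg1' hg2' hg3'
    have hle : ∀ (γ : Fin m → W) (_ : ∀ i, d i = (minOpt {s : S | γ i ≤ s},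
        minOpt {s : S | γ i < s})) i (s : S), (γ i ≤ s ↔ ∃ s₀ ∈ (d i).1, s₀ ≤ s) ∧
        (s ≤ γ i ↔ ¬ ∃ s₀ ∈ (d i).2, s₀ ≤ s) := by
      intro γ hγ i s
      rw [hγ i]
      refine ⟨mem_iff_minOpt (A := {s : S | γ i ≤ s}) (fun a b hab ha => le_trans ha hab) s, ?_⟩
      rw [← mem_iff_minOpt (A := {s : S | γ i < s}) (fun a b hab ha => lt_of_lt_of_le ha hab) s]
      exact not_lt.symm
    have key := h.atp_eq (P := S ⊕ ULift.{u} (Fin m)) (g := Sum.elim Subtype.val (g ∘ ULift.down))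
      (g' := Sum.elim Subtype.val (g' ∘ ULift.down)) (by
        rintro (p | p) (q | q)
        · exact Iff.rfl
        · exact ((hle g hg3 q.down p).2).trans ((hle g' hg3' q.down p).2).symm
        · exact ((hle g hg3 p.down q).1).trans ((hle g' hg3' p.down q).1).symm
        · exact (hg2 p.down q.down).trans (hg2' p.down q.down).symm)
    have h2 := atp_terms key (V := β ⊕ Fin n) (Sum.elim (fun p => (T p).relabel Sum.inl)
      (fun k => (t k).relabel fun i => Sum.inr ⟨i⟩))
    have e : ∀ (γ : Fin m → W) (d : Fin n → M) (_ : ∀ k, d k = (t k).realize (x ∘ γ)),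
        (fun v => (Sum.elim (fun p => (T p).relabel Sum.inl)
          (fun k => (t k).relabel fun i => Sum.inr (ULift.up i)) v : L.Term _).realize
          (x ∘ Sum.elim Subtype.val (γ ∘ ULift.down))) = Sum.elim b d := by
      intro γ d hd
      funext v
      rcases v with p | k
      · simp only [Sum.elim_inl, Term.realize_relabel, hT]
        rfl
      · simp only [Sum.elim_inr, Term.realize_relabel, hd]
        rfl
    rw [e g c hg1, e g' c' hg1'] at h2
    exact h2

end stability

/-! ### Linear orders with many cuts -/

section cuts

/-- There is a linear order of size greater than `c` with a separating subset of size at most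
`c`. -/
theorem exists_many_cuts (c : Cardinal.{u}) (hc : ℵ₀ ≤ c) :
    ∃ (Q : Type u) (_ : LinearOrder Q) (D : Set Q), #D ≤ c ∧ c < #Q ∧
      ∀ q q' : Q, q < q' → ∃ d ∈ D, q < d ∧ d ≤ q' := by
  classical
  have hne : {θ : Cardinal.{u} | c < 2 ^ θ}.Nonempty := ⟨c, Cardinal.cantor c⟩
  -- By minimality of `θ` there are at most `c` binary sequences of each length below `θ`, while
  -- there are more than `c` of length `θ`. The eventually false sequences form the small separating
  -- set.
  let θ := wellFounded_lt.min _ hne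
  have hθ : c < 2 ^ θ := wellFounded_lt.min_mem _ hne
  have hθc : θ ≤ c := wellFounded_lt.min_le (show c ∈ {θ : Cardinal.{u} | c < 2 ^ θ} from Cardinal.cantor c)
  have hmin : ∀ ν < θ, (2 : Cardinal.{u}) ^ ν ≤ c := fun ν hν => by
    by_contra h
    exact wellFounded_lt.not_lt_min _ (show ν ∈ {θ : Cardinal.{u} | c < 2 ^ θ} from not_le.1 h) hν
  have hθ₀ : ℵ₀ ≤ θ := by
    by_contra h
    exact absurd (hc.trans hθ.le) (not_le.2 (Cardinal.power_lt_aleph0 (Cardinal.natCast_lt_aleph0)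
      (not_le.1 h)))
  let T := θ.ord.ToType
  let D : T → Set (Lex (T → Bool)) := fun i => {f | ∀ j, i < j → ofLex f j = false}
  refine ⟨Lex (T → Bool), inferInstance, ⋃ i, D i, ?_, ?_, ?_⟩
  · refine mk_iUnion_le' hc (by simpa [T] using hθc) fun i => ?_
    have h1 : #(D i) ≤ #(Set.Iic i → Bool) := by
      refine Cardinal.mk_le_of_injective (f := fun f j => ofLex f.1 j) ?_
      intro f f' hff
      refine Subtype.ext (ofLex.injective (funext fun j => ?_))
      by_cases hj : j ≤ i
      · exact congrFun hff ⟨j, hj⟩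
      · rw [f.2 j (not_le.1 hj), f'.2 j (not_le.1 hj)]
    refine h1.trans ?_
    have : #(Set.Iic i → Bool) = 2 ^ #(Set.Iic i) := by simp
    rw [this]
    exact hmin _ (mk_Iic_lt hθ₀ i)
  · have : #(Lex (T → Bool)) = 2 ^ θ := by
      change #(T → Bool) = _
      simp [T]
    rwa [this]
  · intro f g hfg
    obtain ⟨i, hi1, hi2⟩ := hfg
    -- The separating point is `g` cut off just after the first place `i` where it differs from `f`.
    refine ⟨toLex fun j => if j ≤ i then ofLex g j else false, ?_, ?_, ?_⟩
    · exact Set.mem_iUnion.2 ⟨i, fun j hj => if_neg (not_le.2 hj)⟩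
    · refine ⟨i, fun j hj => ?_, ?_⟩
      · exact (hi1 j hj).trans (if_pos hj.le).symm
      · exact lt_of_lt_of_eq hi2 (if_pos le_rfl).symm
    · refine Pi.toLex_monotone (a := fun j => if j ≤ i then ofLex g j else false) (b := ofLex g) ?_
      intro j
      dsimp only
      split_ifs
      · exact le_rfl
      · exact Bool.false_le _

end cuts

/-! ### Totally indiscernible bases of the models of cardinality κ -/

/-- The standing hypotheses: `K` is a universal class with arbitrarily large models that is
categorical in the regular cardinal `κ > |L| + ℵ₀`. -/
structure IsCategoricalClass (K : ModelClass L) (κ : Cardinal.{u}) : Prop where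
  univ : IsUniversalClass K
  large : HasArbitrarilyLargeModels K
  lt : L.card + ℵ₀ < κ
  reg : κ.IsRegular
  cat : IsCategoricalIn K κ

/-- A generating family all of whose injective tuples of the same length have the same atomic
type. -/
structure IsBasis (L : FirstOrder.Language.{u, u}) {W M : Type u} [L.Structure M] (x : W → M) :
    Prop where
  generates : Generates L x
  injective : Function.Injective x
  indisc : ∀ (n : ℕ) (g g' : Fin n → W), Function.Injective g → Function.Injective g' →
    atp L (x ∘ g) = atp L (x ∘ g')

theorem atp_eq_of_indisc {W W' M M' : Type u} [L.Structure M] [L.Structure M'] {x : W → M}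
    {x' : W' → M'}
    (h : ∀ (n : ℕ) (g : Fin n → W) (g' : Fin n → W'), Function.Injective g →
      Function.Injective g' → atp L (x ∘ g) = atp L (x' ∘ g'))
    {P : Type*} {g : P → W} {g' : P → W'} (hg : Function.Injective g)
    (hg' : Function.Injective g') : atp L (x ∘ g) = atp L (x' ∘ g') := by
  classical
  refine atp_eq_of_finite fun F => ?_
  have h1 := h F.card (fun i => g (F.equivFin.symm i)) (fun i => g' (F.equivFin.symm i))
    (hg.comp (Subtype.val_injective.comp F.equivFin.symm.injective))
    (hg'.comp (Subtype.val_injective.comp F.equivFin.symm.injective))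
  have h2 := atp_comp h1 F.equivFin
  simpa [Function.comp_def] using h2

theorem IsBasis.atp_eq {W M : Type u} [L.Structure M] {x : W → M} (h : IsBasis L x)
    {P : Type*} {g g' : P → W} (hg : Function.Injective g)
    (hg' : Function.Injective g') : atp L (x ∘ g) = atp L (x ∘ g') :=
  atp_eq_of_indisc h.indisc hg hg'

/-- Adjacent transpositions generate the symmetric group, so order-indiscernibles need only be
tested on swaps of neighbours. -/
theorem atp_comp_perm {M : Type u} [L.Structure M] {n : ℕ} (y : Fin (n + 1) → M)
    (h : ∀ k : Fin n, atp L (y ∘ Equiv.swap k.castSucc k.succ) = atp L y)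
    (σ : Equiv.Perm (Fin (n + 1))) : atp L (y ∘ σ) = atp L y := by
  have hσ : σ ∈ Submonoid.closure
      (Set.range fun i : Fin n => Equiv.swap i.castSucc i.succ) := by
    rw [Equiv.Perm.mclosure_swap_castSucc_succ]
    trivial
  induction hσ using Submonoid.closure_induction with
  | mem τ hτ =>
    obtain ⟨k, rfl⟩ := hτ
    exact h k
  | one => rfl
  | mul σ τ _ _ hσ hτ => exact (atp_comp hσ τ).trans hτ

namespace IsCategoricalClass

variable {κ : Cardinal.{u}} (H : IsCategoricalClass K κ)

include H

theorem aleph0_le : ℵ₀ ≤ κ := H.reg.aleph0_le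

theorem mk_eq_of_generates {I M : Type u} [L.Structure M] {x : I → M} (hI : #I = κ)
    (hx : Generates L x) (hinj : Function.Injective x) : #M = κ := by
  refine le_antisymm ?_ (hI ▸ Cardinal.mk_le_of_injective hinj)
  refine (card_le_of_generates hx).trans ?_
  rw [hI]
  exact (add_le_add le_rfl H.lt.le).trans (Cardinal.add_eq_self H.aleph0_le).le

theorem exists_equiv {M N : Type u} [L.Structure M] [L.Structure N] (hM : K M) (hN : K N)
    (hM' : #M = κ) (hN' : #N = κ) : Nonempty (M ≃[L] N) :=
  H.cat.2 M N hM hN hM' hN'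

/-- Stability. -/
theorem mk_types_le {M : Type u} [L.Structure M] (hM : K M) (hM' : #M = κ)
    {χ : Cardinal.{u}} (hχ : L.card + ℵ₀ ≤ χ) {β : Type u} (b : β → M) (hβ : #β ≤ χ) (n : ℕ) :
    #(Set.range fun c : Fin n → M => atp L (Sum.elim b c)) ≤ χ := by
  obtain ⟨Φ, hΦ⟩ := H.univ.exists_template H.large
  have : Nonempty κ.ord.ToType := Cardinal.nonempty_ord_toType H.reg.pos.ne'
  obtain ⟨N, x, hx, hinj, ht⟩ := hΦ κ.ord.ToType
  obtain ⟨θ⟩ := H.exists_equiv hM N.mem hM' (H.mk_eq_of_generates (by simp) hx hinj)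
  refine le_trans (Cardinal.mk_le_mk_of_subset ?_)
    (HasTemplate.mk_types_le ht hx hχ (fun p => θ (b p)) hβ n)
  rintro _ ⟨c, rfl⟩
  refine ⟨fun k => θ (c k), ?_⟩
  have : (Sum.elim (fun p => θ (b p)) fun k => θ (c k)) =
      fun v => θ.toEmbedding (Sum.elim b c v) := by
    funext v
    rcases v with p | k <;> rfl
  dsimp only
  rw [this, atp_map]

/-- If swapping two neighbours changed the type, indiscernibles could detect their order. An
Ehrenfeucht–Mostowski model over an order with more than λ cuts over a subset of size at most λ
would then realize too many types, contradicting the stability that categoricity transfers from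
well-orders. -/
theorem template_swap {Φ : ∀ n, Set (AtForm L (Fin n))}
    (hΦ : ∀ (I : Type u) [LinearOrder I] [Nonempty I],
      ∃ (M : KModel K) (x : I → M), Generates L x ∧ Function.Injective x ∧ HasTemplate Φ x)
    {n : ℕ} (k : Fin n) {I M : Type u} [LinearOrder I] [L.Structure M] {x : I → M}
    (hx : HasTemplate Φ x) {g : Fin (n + 1) → I} (hg : StrictMono g) :
    atp L (x ∘ g ∘ Equiv.swap k.castSucc k.succ) = atp L (x ∘ g) := by
  by_contra hne
  have hne' : ∀ {I' M' : Type u} [LinearOrder I'] [L.Structure M'] {x' : I' → M'}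
      (_ : HasTemplate Φ x') {g' : Fin (n + 1) → I'} (_ : StrictMono g'),
      atp L (x' ∘ g' ∘ Equiv.swap k.castSucc k.succ) ≠ Φ (n + 1) := by
    intro I' M' _ _ x' hx' g' hg' he
    refine hne ?_
    rw [hx _ _ hg, ← he]
    exact atp_comp ((hx _ _ hg).trans (hx' _ _ hg').symm) _
  obtain ⟨Q, _, D, hD, hQ, hcut⟩ := exists_many_cuts (L.card + ℵ₀) le_add_self
  have hQD : Order.succ (L.card + ℵ₀) ≤ #(Dᶜ : Set Q) := by
    refine Order.succ_le_of_lt ?_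
    by_contra h
    rw [not_lt] at h
    have h1 : #Q ≤ L.card + ℵ₀ := by
      rw [← Cardinal.mk_sum_compl D]
      exact (add_le_add hD h).trans (Cardinal.add_eq_self le_add_self).le
    exact absurd h1 (not_le.2 hQ)
  obtain ⟨Y, hYD, hY⟩ := Cardinal.le_mk_iff_exists_subset.1 hQD
  let Q₁ : Set Q := D ∪ Y
  have hQ₁ : #Q₁ ≤ κ := by
    refine (Cardinal.mk_union_le D Y).trans ?_
    rw [hY]
    exact (add_le_add (hD.trans H.lt.le) (Order.succ_le_of_lt H.lt)).trans
      (Cardinal.add_eq_self H.aleph0_le).le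
  let W := κ.ord.ToType
  let B := ULift.{u} (Fin (n + 1))
  -- The two copies of `B` pad the tuples below and above the two positions to be swapped. The tail
  -- `W` only raises the cardinality to `κ`.
  let I' := Lex (Lex (Lex (B ⊕ Q₁) ⊕ B) ⊕ W)
  let bot : Fin (n + 1) → I' := fun i => toLex (Sum.inl (toLex (Sum.inl (toLex (Sum.inl ⟨i⟩)))))
  let mid : Q₁ → I' := fun q => toLex (Sum.inl (toLex (Sum.inl (toLex (Sum.inr q)))))
  let top : Fin (n + 1) → I' := fun i => toLex (Sum.inl (toLex (Sum.inr ⟨i⟩)))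
  have hbb : ∀ i j, i < j → bot i < bot j := fun i j h =>
    Sum.Lex.inl_lt_inl_iff.2 (Sum.Lex.inl_lt_inl_iff.2 (Sum.Lex.inl_lt_inl_iff.2 h))
  have hbm : ∀ i q, bot i < mid q := fun i q =>
    Sum.Lex.inl_lt_inl_iff.2 (Sum.Lex.inl_lt_inl_iff.2 (Sum.Lex.inl_lt_inr _ _))
  have hbt : ∀ i j, bot i < top j := fun i j =>
    Sum.Lex.inl_lt_inl_iff.2 (Sum.Lex.inl_lt_inr _ _)
  have hmm : ∀ q r, q < r → mid q < mid r := fun q r h =>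
    Sum.Lex.inl_lt_inl_iff.2 (Sum.Lex.inl_lt_inl_iff.2 (Sum.Lex.inr_lt_inr_iff.2 h))
  have hmt : ∀ q j, mid q < top j := fun q j =>
    Sum.Lex.inl_lt_inl_iff.2 (Sum.Lex.inl_lt_inr _ _)
  have htt : ∀ i j, i < j → top i < top j := fun i j h =>
    Sum.Lex.inl_lt_inl_iff.2 (Sum.Lex.inr_lt_inr_iff.2 h)
  have : Nonempty I' := ⟨bot 0⟩
  obtain ⟨N, y, hy, hyinj, hty⟩ := hΦ I'
  have hI' : #I' = κ := by
    change #(((B ⊕ Q₁) ⊕ B) ⊕ W) = κ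
    refine le_antisymm (mk_sum_le H.aleph0_le (mk_sum_le H.aleph0_le (mk_sum_le H.aleph0_le
      (mk_finite_le H.aleph0_le _) hQ₁) (mk_finite_le H.aleph0_le _)) (by simp [W])) ?_
    simp [W]
  have hN := H.mk_eq_of_generates hI' hy hyinj
  let tup : I' → I' → Fin (n + 1) → I' := fun a b i =>
    if i < k.castSucc then bot i else if i = k.castSucc then a else if i = k.succ then b else top i
  have hk : k.castSucc < k.succ := Fin.castSucc_lt_succ
  have htup : ∀ q r, q < r → StrictMono (tup (mid q) (mid r)) := by
    intro q r hqr i j hij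
    have e1 := Fin.lt_def.1 hij
    simp only [tup]
    split_ifs <;> first
      | apply hbb | apply hbm | apply hbt | apply hmm | apply hmt | apply htt | skip
    all_goals simp only [Fin.lt_def, Fin.ext_iff, Fin.val_castSucc, Fin.val_succ] at *
    all_goals first | assumption | omega
  have hswap : ∀ a b, tup a b ∘ Equiv.swap k.castSucc k.succ = tup b a := by
    intro a b
    funext i
    by_cases h1 : i = k.castSucc
    · subst h1
      simp [tup, hk.not_gt, hk.ne']
    by_cases h2 : i = k.succ
    · subst h2
      simp [tup, hk.not_gt, hk.ne']
    · simp [tup, Equiv.swap_apply_of_ne_of_ne h1 h2, h1, h2]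
  let β := B ⊕ (D ⊕ B)
  let b : β → I' := Sum.elim (fun i => bot i.down) (Sum.elim (fun d => mid ⟨d, Or.inl d.2⟩)
    fun i => top i.down)
  have hβ : #β ≤ L.card + ℵ₀ := mk_sum_le le_add_self (mk_finite_le le_add_self _)
    (mk_sum_le le_add_self hD (mk_finite_le le_add_self _))
  have hst := H.mk_types_le N.mem hN le_rfl (fun p => y (b p)) hβ 1
  have hinj : Function.Injective fun q : Y => (⟨_, ⟨fun _ => y (mid ⟨q, Or.inr q.2⟩), rfl⟩⟩ :
      Set.range fun c : Fin 1 → N => atp L (Sum.elim (fun p => y (b p)) c)) := by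
    have key : ∀ q r : Y, q < r → atp L (Sum.elim (fun p => y (b p))
        fun _ : Fin 1 => y (mid ⟨q, Or.inr q.2⟩)) ≠ atp L (Sum.elim (fun p => y (b p))
        fun _ : Fin 1 => y (mid ⟨r, Or.inr r.2⟩)) := by
      intro q r hqr he
      obtain ⟨d, hdD, hqd, hdr⟩ := hcut q r hqr
      have hdr : d < r := lt_of_le_of_ne hdr fun h => hYD r.2 (h ▸ hdD)
      -- For `d` strictly between `q` and `r`, inserting `q` gives an increasing tuple and inserting
      -- `r` the swapped one, so this selection of coordinates distinguishes the two types.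
      let m : Fin (n + 1) → β ⊕ Fin 1 := fun i =>
        if i < k.castSucc then Sum.inl (Sum.inl ⟨i⟩) else if i = k.castSucc then Sum.inr 0
        else if i = k.succ then Sum.inl (Sum.inr (Sum.inl ⟨d, hdD⟩))
        else Sum.inl (Sum.inr (Sum.inr ⟨i⟩))
      have hm : ∀ a : I', Sum.elim (fun p => y (b p)) (fun _ : Fin 1 => y a) ∘ m =
          y ∘ tup a (mid ⟨d, Or.inl hdD⟩) := by
        intro a
        funext i
        simp only [m, tup, Function.comp]
        split_ifs <;> rfl
      have h1 := atp_comp he m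
      rw [hm, hm, hty _ _ (htup _ _ (by exact hqd)), ← hswap] at h1
      exact hne' hty (htup ⟨d, Or.inl hdD⟩ ⟨r, Or.inr r.2⟩ hdr) h1.symm
    intro q r hqr
    have hqr := congrArg Subtype.val hqr
    rcases lt_trichotomy q r with h | h | h
    · exact absurd hqr (key q r h)
    · exact h
    · exact absurd hqr.symm (key r q h)
  have := (Cardinal.mk_le_of_injective hinj).trans hst
  rw [hY] at this
  exact absurd this (not_le.2 (Order.lt_succ _))

/-- Models of cardinality `κ` are generated by totally indiscernible families. -/
theorem exists_isBasis {M : Type u} [L.Structure M] (hM : K M) (hM' : #M = κ) :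
    ∃ x : κ.ord.ToType → M, IsBasis L x := by
  obtain ⟨Φ, hΦ⟩ := H.univ.exists_template H.large
  have : Nonempty κ.ord.ToType := Cardinal.nonempty_ord_toType H.reg.pos.ne'
  obtain ⟨N, x, hx, hinj, ht⟩ := hΦ κ.ord.ToType
  have key : ∀ (n : ℕ) (g : Fin n → κ.ord.ToType), Function.Injective g →
      atp L (x ∘ g) = Φ n := by
    intro n g hg
    have hs : StrictMono (g ∘ Tuple.sort g) :=
      (Tuple.monotone_sort g).strictMono_of_injective (hg.comp (Tuple.sort g).injective)
    rw [← ht n _ hs]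
    rcases n with _ | n
    · congr 1
      funext i
      exact i.elim0
    · have h1 := atp_comp_perm (x ∘ g ∘ Tuple.sort g)
        (fun k => H.template_swap hΦ k ht hs) (Tuple.sort g)⁻¹
      rw [← h1]
      congr 1
      funext i
      simp
  obtain ⟨θ⟩ := H.exists_equiv N.mem hM (H.mk_eq_of_generates (by simp) hx hinj) hM'
  refine ⟨fun i => θ (x i), ?_, θ.injective.comp hinj, ?_⟩
  · intro m
    obtain ⟨t, ht⟩ := hx (θ.symm m)
    refine ⟨t, ?_⟩
    have h1 := HomClass.realize_term (g := θ) (t := t) (v := x)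
    rw [ht] at h1
    simpa [Function.comp_def] using h1
  · intro n g g' hg hg'
    have h1 := (atp_map θ.toEmbedding (x ∘ g)).trans (key n g hg)
    have h2 := (atp_map θ.toEmbedding (x ∘ g')).trans (key n g' hg')
    exact h1.trans h2.symm

end IsCategoricalClass

/-! ### Diagrams over sets of variables -/

section diagrams

variable {V : Type u}

/-- The atomic formulas with variables in the set `S`. -/
def formsIn (L : FirstOrder.Language.{u, u}) {V : Type u} (S : Set V) : Set (AtForm L V) :=
  Set.range (AtForm.relabel (Subtype.val : S → V))

theorem formsIn_mono {S T : Set V} (h : S ⊆ T) : formsIn L S ⊆ formsIn L T := by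
  rintro _ ⟨φ, rfl⟩
  exact ⟨φ.relabel (Set.inclusion h), by rw [relabel_relabel]; rfl⟩

/-- The atomic formulas with variables in `S` that are satisfied by `v`. -/
def diag {M : Type u} [L.Structure M] (S : Set V) (v : V → M) : Set (AtForm L V) :=
  {φ | φ ∈ formsIn L S ∧ Holds v φ}

theorem diag_eq_iff {M N : Type u} [L.Structure M] [L.Structure N] {S : Set V} {v : V → M}
    {v' : V → N} : diag (L := L) S v = diag S v' ↔
      atp L (fun s : S => v s) = atp L (fun s : S => v' s) := by
  constructor
  · intro h
    rw [atp_eq_iff]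
    intro φ
    have := Set.ext_iff.1 h (φ.relabel Subtype.val)
    simp only [diag, Set.mem_ofPred_eq, holds_relabel] at this
    exact (and_congr_right_iff.1 this) ⟨φ, rfl⟩
  · intro h
    ext φ
    refine and_congr_right ?_
    rintro ⟨φ, rfl⟩
    rw [holds_relabel, holds_relabel]
    exact holds_iff_of_atp_eq h φ

theorem diag_inter {M : Type u} [L.Structure M] {S T : Set V} (h : S ⊆ T) (v : V → M) :
    diag (L := L) T v ∩ formsIn L S = diag S v := by
  ext φ
  exact ⟨fun hφ => ⟨hφ.2, hφ.1.2⟩, fun hφ => ⟨⟨formsIn_mono h hφ.1, hφ.2⟩, hφ.1⟩⟩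

theorem diag_subset {M : Type u} [L.Structure M] {S : Set V} {v : V → M} :
    diag (L := L) S v ⊆ formsIn L S := fun _ h => h.1

end diagrams

/-! ### Coherent chains of diagrams and their unions -/

section chains

variable {W : Type u}

/-- The variables available after the stages in `A`. -/
def lev (A : Set W) : Set (W ⊕ (W × ℕ)) :=
  {v | ∀ q, v = Sum.inr q → q.1 ∈ A}

theorem inl_mem_lev (A : Set W) (w : W) : Sum.inl w ∈ lev A := fun _ h => nomatch h

theorem inr_mem_lev {A : Set W} {q : W × ℕ} : Sum.inr q ∈ lev A ↔ q.1 ∈ A :=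
  ⟨fun h => h q rfl, fun h _ hq => Sum.inr.inj hq ▸ h⟩

theorem lev_mono {A B : Set W} (h : A ⊆ B) : lev A ⊆ lev B := fun _ hv q hq => h (hv q hq)

/-- The diagram after the stages in `A`, when stage `i` produces the diagram `p i`. -/
def levDiag (base : Set (AtForm L (W ⊕ (W × ℕ)))) (p : W → Set (AtForm L (W ⊕ (W × ℕ))))
    (A : Set W) : Set (AtForm L (W ⊕ (W × ℕ))) :=
  base ∪ ⋃ j ∈ A, p j

variable [LinearOrder W]

/-- The diagram `p i` extends the union of `base` and the previous diagrams to a diagram of a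
family in a member of `K`. -/
def IsStage (K : ModelClass L) (base : Set (AtForm L (W ⊕ (W × ℕ))))
    (p : W → Set (AtForm L (W ⊕ (W × ℕ)))) (i : W) : Prop :=
  ∃ (N : KModel K) (v : W ⊕ (W × ℕ) → N), diag (lev (Set.Iio i)) v = levDiag base p (Set.Iio i) ∧
    diag (lev (Set.Iic i)) v = p i

variable {base : Set (AtForm L (W ⊕ (W × ℕ)))} {p : W → Set (AtForm L (W ⊕ (W × ℕ)))}

theorem IsStage.inter {i : W} (h : IsStage K base p i) :
    p i ∩ formsIn L (lev (Set.Iio i)) = levDiag base p (Set.Iio i) := by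
  obtain ⟨N, v, h1, h2⟩ := h
  rw [← h2, ← h1]
  exact diag_inter (lev_mono Set.Iio_subset_Iic_self) v

theorem IsStage.subset {i : W} (h : IsStage K base p i) : p i ⊆ formsIn L (lev (Set.Iic i)) := by
  obtain ⟨N, v, h1, h2⟩ := h
  rw [← h2]
  exact diag_subset

theorem IsStage.levDiag_subset {i : W} (h : IsStage K base p i) :
    levDiag base p (Set.Iio i) ⊆ p i := by
  rw [← h.inter]
  exact Set.inter_subset_left

variable [WellFoundedLT W]

/-- Later stages decide nothing new about earlier variables: a formula of level `j` in a later
diagram already comes from the union below it, and well-founded descent brings it down to `p j`. -/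
theorem levDiag_inter {A : Set W} (hA : IsLowerSet A) (h : ∀ i ∈ A, IsStage K base p i) {j : W}
    (hj : j ∈ A) : levDiag base p A ∩ formsIn L (lev (Set.Iic j)) = p j := by
  have hb : base ⊆ p j := fun φ hφ => (h j hj).levDiag_subset (Or.inl hφ)
  have hlt : ∀ m < j, p m ⊆ p j := fun m hm φ hφ =>
    (h j hj).levDiag_subset (Or.inr (Set.mem_biUnion (show m ∈ Set.Iio j from hm) hφ))
  have hgt : ∀ m ∈ A, j < m → p m ∩ formsIn L (lev (Set.Iic j)) ⊆ p j := by
    intro m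
    induction m using WellFoundedLT.induction with
    | ind m ih =>
    rintro hm hjm φ ⟨hφ, hφ'⟩
    have h1 : φ ∈ levDiag base p (Set.Iio m) := by
      rw [← (h m hm).inter]
      exact ⟨hφ, formsIn_mono (lev_mono (Set.Iic_subset_Iio.2 hjm)) hφ'⟩
    rcases h1 with h1 | h1
    · exact hb h1
    · obtain ⟨m', hm', h2⟩ := Set.mem_iUnion₂.1 h1
      rcases lt_trichotomy m' j with h3 | rfl | h3
      · exact hlt m' h3 h2
      · exact h2
      · exact ih m' hm' (hA (le_of_lt hm') hm) h3 ⟨h2, hφ'⟩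
  apply Set.Subset.antisymm
  · rintro φ ⟨hφ | hφ, hφ'⟩
    · exact hb hφ
    · obtain ⟨m, hm, h2⟩ := Set.mem_iUnion₂.1 hφ
      rcases lt_trichotomy m j with h3 | rfl | h3
      · exact hlt m h3 h2
      · exact h2
      · exact hgt m hm h3 ⟨h2, hφ'⟩
  · exact fun φ hφ => ⟨Or.inr (Set.mem_biUnion hj hφ), (h j hj).subset hφ⟩

theorem levDiag_inter_empty {A : Set W} (hA : IsLowerSet A) (h : ∀ i ∈ A, IsStage K base p i)
    (hbase : base ⊆ formsIn L (lev (∅ : Set W))) :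
    levDiag base p A ∩ formsIn L (lev ∅) = base := by
  have hgt : ∀ m ∈ A, p m ∩ formsIn L (lev ∅) ⊆ base := by
    intro m
    induction m using WellFoundedLT.induction with
    | ind m ih =>
    rintro hm φ ⟨hφ, hφ'⟩
    have h1 : φ ∈ levDiag base p (Set.Iio m) := by
      rw [← (h m hm).inter]
      exact ⟨hφ, formsIn_mono (lev_mono (Set.empty_subset _)) hφ'⟩
    rcases h1 with h1 | h1
    · exact h1
    · obtain ⟨m', hm', h2⟩ := Set.mem_iUnion₂.1 h1
      exact ih m' hm' (hA (le_of_lt hm') hm) ⟨h2, hφ'⟩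
  apply Set.Subset.antisymm
  · rintro φ ⟨hφ | hφ, hφ'⟩
    · exact hφ
    · obtain ⟨m, hm, h2⟩ := Set.mem_iUnion₂.1 hφ
      exact hgt m hm ⟨h2, hφ'⟩
  · exact fun φ hφ => ⟨Or.inl hφ, hbase hφ⟩

/-- Finitely many variables lie in the level of their largest stage, or in the base if no stage
occurs. There the union coincides with the diagram of a family in a member of `K`, so compactness
applies. -/
theorem exists_realization_levDiag (hK : IsUniversalClass K) [Nonempty W] {N₀ : KModel K}
    {v₀ : W ⊕ (W × ℕ) → N₀} (hbase : base = diag (lev ∅) v₀) {A : Set W} (hA : IsLowerSet A)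
    (h : ∀ i ∈ A, IsStage K base p i) :
    ∃ (M : KModel K) (x : lev A → M) (v : W ⊕ (W × ℕ) → M), Generates L x ∧ (∀ s, x s = v s) ∧
      diag (lev A) v = levDiag base p A := by
  classical
  have : Nonempty (lev A) := ⟨⟨Sum.inl (Classical.arbitrary W), inl_mem_lev _ _⟩⟩
  have h1 : ∀ F : Finset (lev A), ∃ (N : KModel K) (v : W ⊕ (W × ℕ) → N),
      ∀ φ : AtForm L F, Holds (fun s : F => v s) φ ↔
        φ.relabel (fun s : F => (s : W ⊕ (W × ℕ))) ∈ levDiag base p A := by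
    intro F
    have hform : ∀ {S : Set (W ⊕ (W × ℕ))}, (∀ s ∈ F, (s : W ⊕ (W × ℕ)) ∈ S) → ∀ φ : AtForm L F,
        φ.relabel (fun s : F => (s : W ⊕ (W × ℕ))) ∈ formsIn L S := by
      intro S hS φ
      exact ⟨φ.relabel (fun s : F => ⟨s, hS s s.2⟩), by rw [relabel_relabel]; rfl⟩
    have hfin : ∀ {S : Set (W ⊕ (W × ℕ))} (N : KModel K) (v : W ⊕ (W × ℕ) → N),
        (∀ s ∈ F, (s : W ⊕ (W × ℕ)) ∈ S) → diag S v = levDiag base p A ∩ formsIn L S →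
        ∀ φ : AtForm L F, Holds (fun s : F => v s) φ ↔
        φ.relabel (fun s : F => (s : W ⊕ (W × ℕ))) ∈ levDiag base p A := by
      intro S N v hS hv φ
      have h2 := Set.ext_iff.1 hv (φ.relabel (fun s : F => (s : W ⊕ (W × ℕ))))
      simp only [diag, Set.mem_ofPred_eq, Set.mem_inter_iff, hform hS φ, true_and, and_true,
        holds_relabel] at h2
      exact h2
    by_cases hF : ∃ s ∈ F, ∃ q, (s : W ⊕ (W × ℕ)) = Sum.inr q
    · let G : Finset W := (F.image Subtype.val).biUnion fun s => s.elim (fun _ => ∅) fun q => {q.1}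
      have hG : ∀ s ∈ F, ∀ q, (s : W ⊕ (W × ℕ)) = Sum.inr q → q.1 ∈ G := by
        intro s hs q hq
        refine Finset.mem_biUnion.2 ⟨s, Finset.mem_image_of_mem _ hs, ?_⟩
        rw [hq]
        simp
      have hGA : ∀ w ∈ G, w ∈ A := by
        intro w hw
        obtain ⟨s, hs, hw⟩ := Finset.mem_biUnion.1 hw
        obtain ⟨s, -, rfl⟩ := Finset.mem_image.1 hs
        obtain ⟨s | q, hsA⟩ := s
        · simp at hw
        · simp only [Sum.elim_inr, Finset.mem_singleton] at hw
          rw [hw]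
          exact inr_mem_lev.1 hsA
      have hGne : G.Nonempty := by
        obtain ⟨s, hs, q, hq⟩ := hF
        exact ⟨q.1, hG s hs q hq⟩
      let j := G.max' hGne
      have hjA : j ∈ A := hGA _ (G.max'_mem hGne)
      obtain ⟨N, v, -, hv⟩ := h j hjA
      refine ⟨N, v, hfin (S := lev (Set.Iic j)) N v ?_ (hv.trans (levDiag_inter hA h hjA).symm)⟩
      exact fun s hs q hq => G.le_max' _ (hG s hs q hq)
    · refine ⟨N₀, v₀, hfin (S := lev ∅) N₀ v₀ ?_ ?_⟩
      · exact fun s hs q hq => absurd ⟨s, hs, q, hq⟩ hF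
      · rw [levDiag_inter_empty hA h (hbase ▸ diag_subset), hbase]
  choose N v hv using h1
  obtain ⟨M, x, hx, hxF⟩ := hK.exists_realization (I := lev A) N (fun F s => v F s) (by
    intro F G hFG
    rw [atp_eq_iff]
    intro φ
    have h2 := hv G (φ.relabel (fun s : F => ⟨s, hFG s.2⟩))
    rw [holds_relabel, relabel_relabel] at h2
    exact (hv F φ).trans h2.symm)
  let w : W ⊕ (W × ℕ) → M := fun s => if hs : s ∈ lev A then x ⟨s, hs⟩ else
    x (Classical.arbitrary _)
  have hw : ∀ s : lev A, x s = w s := fun s => by simp [w]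
  refine ⟨M, x, w, hx, hw, ?_⟩
  ext φ
  have hsub : levDiag base p A ⊆ formsIn L (lev A) := by
    rintro φ (hφ | hφ)
    · exact formsIn_mono (lev_mono (Set.empty_subset _)) (diag_subset (hbase ▸ hφ))
    · obtain ⟨m, hm, h2⟩ := Set.mem_iUnion₂.1 hφ
      exact formsIn_mono (lev_mono (fun a ha => hA ha hm)) ((h m hm).subset h2)
  by_cases hφ : φ ∈ formsIn L (lev A)
  · have h3 : φ ∈ diag (lev A) w ↔ Holds w φ := and_iff_right hφ
    rw [h3]
    obtain ⟨φ, rfl⟩ := hφ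
    obtain ⟨F, hF⟩ := exists_finset_atForm φ
    obtain ⟨φ, rfl⟩ := hF F subset_rfl
    rw [relabel_relabel, holds_relabel]
    refine Iff.trans ?_ (hv F φ)
    have h4 := holds_iff_of_atp_eq (hxF F) φ
    rw [← h4]
    have : (w ∘ Subtype.val ∘ Subtype.val : F → M) = fun i : F => x i := by
      funext s
      exact (hw s).symm
    exact iff_of_eq (congrArg (fun z => Holds z φ) this)
  · exact iff_of_false (fun h5 => hφ h5.1) fun h5 => hφ (hsub h5)

end chains

/-! ### Chains that add new types -/

section chains

variable {W : Type u} [LinearOrder W]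

/-- The variables of index below `k`. -/
def lowVars (k : W) : Set (W ⊕ (W × ℕ)) :=
  {v | Sum.elim id Prod.fst v < k}

theorem lowVars_subset {k : W} {A : Set W} (h : Set.Iio k ⊆ A) : lowVars k ⊆ lev A := by
  rintro v hv q rfl
  exact h hv

theorem mk_lowVars_le {χ : Cardinal.{u}} (hχ : ℵ₀ ≤ χ) {k : W} (hk : #(Set.Iio k) ≤ χ) :
    #(lowVars k) ≤ χ := by
  let f : lowVars k → Set.Iio k ⊕ (Set.Iio k × ULift.{u} ℕ) := fun s => match s with
    | ⟨Sum.inl w, h⟩ => Sum.inl ⟨w, h⟩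
    | ⟨Sum.inr q, h⟩ => Sum.inr (⟨q.1, h⟩, ⟨q.2⟩)
  have hf : Function.Injective f := by
    rintro ⟨w | ⟨w, a⟩, h⟩ ⟨w' | ⟨w', a'⟩, h'⟩ hh
    · have h1 : w = w' := congrArg Subtype.val (Sum.inl.inj hh)
      subst h1
      rfl
    · cases hh
    · cases hh
    · obtain ⟨h1, h2⟩ := Prod.mk.inj (Sum.inr.inj hh)
      have h3 : w = w' := congrArg Subtype.val h1
      have h4 : a = a' := congrArg ULift.down h2
      clear h1 h2
      subst h3 h4
      rfl
  exact (Cardinal.mk_le_of_injective hf).trans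
    (mk_sum_le hχ hk (mk_prod_le hχ hk (by simpa using hχ)))

/-- At stage `i` of a chain a tuple is added that realizes a new type over the variables below
`k`. -/
def AddsType (k : W) (n : ℕ) (i : W) {N : Type u} [L.Structure N] (v : W ⊕ (W × ℕ) → N) : Prop :=
  k ≤ i ∧ ∀ τ : Fin n → L.Term (lev (Set.Iio i)),
    atp L (Sum.elim (fun s : lowVars k => v s) fun m : Fin n => v (Sum.inr (i, m))) ≠
    atp L (Sum.elim (fun s : lowVars k => v s) fun m : Fin n =>
      (τ m).realize fun s : lev (Set.Iio i) => v s)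

/-- Newness is decided by the diagram of the stage, so it passes from the witness used to build the
stage to the final model. -/
theorem AddsType.congr {k : W} {n : ℕ} {i : W} {N N' : Type u} [L.Structure N] [L.Structure N']
    {v : W ⊕ (W × ℕ) → N} {v' : W ⊕ (W × ℕ) → N'} (h : AddsType (L := L) k n i v)
    (hv : diag (L := L) (lev (Set.Iic i)) v = diag (lev (Set.Iic i)) v') :
    AddsType (L := L) k n i v' := by
  refine ⟨h.1, fun τ he => h.2 τ ?_⟩
  rw [diag_eq_iff] at hv
  have hlow : lowVars k ⊆ lev (Set.Iic i) :=
    lowVars_subset fun a ha => (lt_of_lt_of_le ha h.1).le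
  have hlev : lev (Set.Iio i) ⊆ lev (Set.Iic i) := lev_mono Set.Iio_subset_Iic_self
  have h1 := atp_terms hv (V := lowVars k ⊕ Fin n)
    (Sum.elim (fun s => Term.var (Set.inclusion hlow s))
      fun m => Term.var ⟨Sum.inr (i, m), inr_mem_lev.2 (Set.mem_Iic.2 le_rfl)⟩)
  have h2 := atp_terms hv (V := lowVars k ⊕ Fin n)
    (Sum.elim (fun s => Term.var (Set.inclusion hlow s))
      fun m => (τ m).relabel (Set.inclusion hlev))
  have e1 : ∀ {N : Type u} [L.Structure N] (v : W ⊕ (W × ℕ) → N),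
      (fun z => (Sum.elim (fun s => Term.var (Set.inclusion hlow s))
      (fun m : Fin n => Term.var ⟨Sum.inr (i, m), inr_mem_lev.2 (Set.mem_Iic.2 le_rfl)⟩) z :
        L.Term (lev (Set.Iic i))).realize fun s : lev (Set.Iic i) => v s) =
      Sum.elim (fun s : lowVars k => v s) fun m : Fin n => v (Sum.inr (i, m)) := by
    intro N _ v
    funext z
    rcases z with z | z <;> rfl
  have e2 : ∀ {N : Type u} [L.Structure N] (v : W ⊕ (W × ℕ) → N),
      (fun z => (Sum.elim (fun s => Term.var (Set.inclusion hlow s))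
      (fun m : Fin n => (τ m).relabel (Set.inclusion hlev)) z :
        L.Term (lev (Set.Iic i))).realize fun s : lev (Set.Iic i) => v s) =
      Sum.elim (fun s : lowVars k => v s) fun m : Fin n =>
      (τ m).realize fun s : lev (Set.Iio i) => v s := by
    intro N _ v
    funext z
    rcases z with z | z
    · rfl
    · simp only [Sum.elim_inr, Term.realize_relabel]
      rfl
  rw [e1, e1] at h1
  rw [e2, e2] at h2
  rw [h1, h2, he]

variable [WellFoundedLT W]

/-- A chain of diagrams that adds new types whenever possible. -/
theorem exists_stages (hK : IsUniversalClass K) [Nonempty W] (N₀ : KModel K)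
    (v₀ : W ⊕ (W × ℕ) → N₀) (g : W → W × ℕ) :
    ∃ p : W → Set (AtForm L (W ⊕ (W × ℕ))), ∀ i, IsStage K (diag (lev ∅) v₀) p i ∧
      ∃ (N : KModel K) (v : W ⊕ (W × ℕ) → N),
        diag (lev (Set.Iio i)) v = levDiag (diag (lev ∅) v₀) p (Set.Iio i) ∧
        diag (lev (Set.Iic i)) v = p i ∧
        ((∃ (N' : KModel K) (v' : W ⊕ (W × ℕ) → N'),
          diag (lev (Set.Iio i)) v' = levDiag (diag (lev ∅) v₀) p (Set.Iio i) ∧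
            AddsType (L := L) (g i).1 (g i).2 i v') → AddsType (L := L) (g i).1 (g i).2 i v) := by
  classical
  let Step : Set (AtForm L (W ⊕ (W × ℕ))) → W → Set (AtForm L (W ⊕ (W × ℕ))) → Prop :=
    fun D i q => ∃ (N : KModel K) (v : W ⊕ (W × ℕ) → N), diag (lev (Set.Iio i)) v = D ∧
      diag (lev (Set.Iic i)) v = q ∧
      ((∃ (N' : KModel K) (v' : W ⊕ (W × ℕ) → N'), diag (lev (Set.Iio i)) v' = D ∧
        AddsType (L := L) (g i).1 (g i).2 i v') → AddsType (L := L) (g i).1 (g i).2 i v)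
  have hStep : ∀ D i, (∃ (N : KModel K) (v : W ⊕ (W × ℕ) → N), diag (lev (Set.Iio i)) v = D) →
      ∃ q, Step D i q := by
    rintro D i ⟨N, v, hv⟩
    by_cases h : ∃ (N' : KModel K) (v' : W ⊕ (W × ℕ) → N'), diag (lev (Set.Iio i)) v' = D ∧
        AddsType (L := L) (g i).1 (g i).2 i v'
    · obtain ⟨N', v', h1, h2⟩ := h
      exact ⟨_, N', v', h1, rfl, fun _ => h2⟩
    · exact ⟨_, N, v, hv, rfl, fun h' => absurd h' h⟩
  -- The default ∅ is never used: the union of the earlier stages is always realized, so a next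
  -- diagram exists.
  let p : W → Set (AtForm L (W ⊕ (W × ℕ))) := wellFounded_lt.fix fun i rec =>
    if h : ∃ q, Step (diag (lev ∅) v₀ ∪ ⋃ j, ⋃ hj : j < i, rec j hj) i q then h.choose else ∅
  have hp : ∀ i, (∃ q, Step (levDiag (diag (lev ∅) v₀) p (Set.Iio i)) i q) →
      Step (levDiag (diag (lev ∅) v₀) p (Set.Iio i)) i (p i) := by
    intro i h
    have e : p i = h.choose := by
      conv_lhs => rw [show p = wellFounded_lt.fix _ from rfl, WellFounded.fix_eq]
      exact dif_pos h
    rw [e]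
    exact h.choose_spec
  have hst : ∀ i, Step (levDiag (diag (lev ∅) v₀) p (Set.Iio i)) i (p i) := by
    intro i
    induction i using WellFoundedLT.induction with
    | ind i ih =>
    refine hp i (hStep _ _ ?_)
    have h1 : ∀ j ∈ Set.Iio i, IsStage K (diag (lev ∅) v₀) p j := by
      intro j hj
      obtain ⟨N, v, h1, h2, -⟩ := ih j hj
      exact ⟨N, v, h1, h2⟩
    obtain ⟨M, x, v, -, -, hv⟩ := exists_realization_levDiag hK (v₀ := v₀) rfl
      (isLowerSet_Iio i) h1
    exact ⟨M, v, hv⟩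
  refine ⟨p, fun i => ⟨?_, hst i⟩⟩
  obtain ⟨N, v, h1, h2, -⟩ := hst i
  exact ⟨N, v, h1, h2⟩

end chains

/-! ### Saturation of the models of cardinality κ -/

theorem exists_gt_of_small {κ : Cardinal.{u}} (hκ : κ.IsRegular) {I : Type u} (hI : #I < κ)
    (f : I → κ.ord.ToType) : ∃ k, ∀ i, f i < k := by
  by_contra h
  push Not at h
  have h1 : IsCofinal (Set.range f) := by
    intro k
    obtain ⟨i, hi⟩ := h k
    exact ⟨f i, ⟨i, rfl⟩, hi⟩
  have h2 := Order.cof_le h1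
  rw [← Ordinal.cof_type, Ordinal.type_toType, hκ.cof_ord] at h2
  exact absurd (h2.trans Cardinal.mk_range_le) (not_le.2 hI)

namespace IsCategoricalClass

variable {κ : Cardinal.{u}} (H : IsCategoricalClass K κ)

include H

theorem aleph0_lt : ℵ₀ < κ := lt_of_le_of_lt le_add_self H.lt

/-- Some model of cardinality `κ` realizes all types over small subsets that are realized in
extensions. -/
theorem exists_maximal : ∃ M : KModel K, #M = κ ∧
    ∀ (N : Type u) [L.Structure N] (_ : K N) (e : M ↪[L] N) (β : Type u) (b : β → M) (_ : #β < κ)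
      (n : ℕ) (c : Fin n → N), ∃ c' : Fin n → M,
        atp L (Sum.elim b c') = atp L (Sum.elim (fun i => e (b i)) c) := by
  classical
  let W := κ.ord.ToType
  have hW : #W = κ := by simp [W]
  have : NoMaxOrder W := Cardinal.noMaxOrder H.aleph0_le
  have : Nonempty W := Cardinal.nonempty_ord_toType H.reg.pos.ne'
  obtain ⟨⟨N₀, _, hN₀, hN₀'⟩, -⟩ := H.cat
  obtain ⟨e₀⟩ : Nonempty (W ≃ N₀) := Cardinal.eq.1 (hW.trans hN₀'.symm)
  let v₀ : W ⊕ (W × ℕ) → N₀ := Sum.elim e₀ fun q => e₀ q.1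
  -- The second factor `W` repeats every task `(k, n)` κ many times.
  obtain ⟨E⟩ : Nonempty (W ≃ (W × ULift.{u} ℕ) × W) := by
    refine Cardinal.eq.1 (le_antisymm ?_ ?_)
    · exact Cardinal.mk_le_of_injective (f := fun w => ((w, ⟨0⟩), w)) fun a b h =>
        (Prod.mk.inj h).2
    · rw [hW]
      exact mk_prod_le H.aleph0_le (mk_prod_le H.aleph0_le hW.le (by simpa using H.aleph0_le)) hW.le
  let g : W → W × ℕ := fun i => ((E i).1.1, (E i).1.2.down)
  obtain ⟨p, hp⟩ := exists_stages H.univ ⟨N₀, hN₀⟩ v₀ g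
  obtain ⟨M, x, v, hx, hxv, hv⟩ := exists_realization_levDiag H.univ (K := K)
    (N₀ := ⟨N₀, hN₀⟩) (v₀ := v₀) rfl isLowerSet_univ fun i _ => (hp i).1
  have hIic : ∀ i, diag (lev (Set.Iic i)) v = p i := fun i => by
    rw [← levDiag_inter isLowerSet_univ (fun i _ => (hp i).1) (Set.mem_univ i), ← hv]
    exact (diag_inter (lev_mono (Set.subset_univ _)) v).symm
  have hIio : ∀ i, diag (lev (Set.Iio i)) v = levDiag (diag (lev ∅) v₀) p (Set.Iio i) := fun i => by
    rw [← (hp i).1.inter, ← hIic i]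
    exact (diag_inter (lev_mono Set.Iio_subset_Iic_self) v).symm
  have hVκ : #(W ⊕ (W × ℕ)) ≤ κ := mk_sum_le H.aleph0_le hW.le (by
    simpa [hW] using (mul_le_mul' (le_refl κ) H.aleph0_le).trans
      (Cardinal.mul_eq_self H.aleph0_le).le)
  have hMκ : #M = κ := by
    apply le_antisymm
    · refine (card_le_of_generates hx).trans ?_
      exact (add_le_add ((Cardinal.mk_subtype_le _).trans hVκ) H.lt.le).trans
        (Cardinal.add_eq_self H.aleph0_le).le
    · have h1 : diag (L := L) (lev (∅ : Set W)) v = diag (lev ∅) v₀ := by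
        rw [← levDiag_inter_empty isLowerSet_univ (fun i _ => (hp i).1) diag_subset, ← hv]
        exact (diag_inter (lev_mono (Set.empty_subset _)) v).symm
      rw [diag_eq_iff] at h1
      rw [← hW]
      refine Cardinal.mk_le_of_injective (f := fun w => v (Sum.inl w)) fun a b hab => ?_
      exact e₀.injective ((atp_eq_iff_apply h1 ⟨Sum.inl a, inl_mem_lev _ _⟩
        ⟨Sum.inl b, inl_mem_lev _ _⟩).1 hab)
  have hlow : ∀ k : W, ∃ χ, L.card + ℵ₀ ≤ χ ∧ χ < κ ∧ #(lowVars k) ≤ χ := by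
    intro k
    have hχ : ℵ₀ ≤ max (L.card + ℵ₀) #(Set.Iio k) := le_max_of_le_left le_add_self
    exact ⟨max (L.card + ℵ₀) #(Set.Iio k), le_max_left _ _, max_lt H.lt (mk_Iio_lt k),
      mk_lowVars_le hχ (le_max_right _ _)⟩
  -- Otherwise every occurrence of the task `(k, n)` at or after `k` adds a type over `lowVars k`
  -- different from the earlier ones. That makes κ types over fewer than κ parameters, against
  -- stability.
  have hex : ∀ (k : W) (n : ℕ), ∃ i, k ≤ i ∧ ¬ ∃ (N' : KModel K) (v' : W ⊕ (W × ℕ) → N'),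
      diag (lev (Set.Iio i)) v' = diag (L := L) (lev (Set.Iio i)) v ∧
        AddsType (L := L) k n i v' := by
    intro k n
    by_contra hcon
    push Not at hcon
    let A : Set W := {i | g i = (k, n) ∧ k ≤ i}
    have hA : ∀ i ∈ A, AddsType (L := L) k n i v := by
      rintro i ⟨hi, hki⟩
      obtain ⟨N, w, h1, h2, h3⟩ := (hp i).2
      rw [hi] at h3
      obtain ⟨N', v', h4, h5⟩ := hcon i hki
      exact (h3 ⟨N', v', h4.trans (hIio i), h5⟩).congr (h2.trans (hIic i).symm)
    obtain ⟨χ, hχ1, hχ2, hχ3⟩ := hlow k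
    have hcard := H.mk_types_le M.mem hMκ hχ1 (fun s : lowVars k => v s) hχ3 n
    have hinj : Function.Injective fun i : A => (⟨_, ⟨fun m : Fin n => v (Sum.inr (i, m)), rfl⟩⟩ :
        Set.range fun c : Fin n → M => atp L (Sum.elim (fun s : lowVars k => v s) c)) := by
      have key : ∀ i j : A, i < j →
          atp L (Sum.elim (fun s : lowVars k => v s) fun m : Fin n => v (Sum.inr (j, m))) ≠
          atp L (Sum.elim (fun s : lowVars k => v s) fun m : Fin n => v (Sum.inr (i, m))) := by
        intro i j hij
        exact (hA j j.2).2 fun m => Term.var ⟨Sum.inr (i, m), inr_mem_lev.2 hij⟩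
      intro i j hij
      have hij := congrArg Subtype.val hij
      rcases lt_trichotomy i j with h | h | h
      · exact absurd hij.symm (key i j h)
      · exact h
      · exact absurd hij (key j i h)
    have hAκ : #A < κ := ((Cardinal.mk_le_of_injective hinj).trans hcard).trans_lt hχ2
    have h1 : κ ≤ #(Set.Iio k ∪ A : Set W) := by
      refine hW.symm.le.trans ?_
      refine Cardinal.mk_le_of_injective
        (f := fun w => ⟨E.symm ((k, ⟨n⟩), w), ?_⟩) fun a b hab => ?_
      · rcases lt_or_ge (E.symm ((k, ⟨n⟩), w)) k with h | h
        · exact Or.inl h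
        · exact Or.inr ⟨by simp [g], h⟩
      · have := E.symm.injective (congrArg Subtype.val hab)
        exact (Prod.mk.inj this).2
    exact absurd (h1.trans (Cardinal.mk_union_le _ _))
      (not_le.2 (Cardinal.add_lt_of_lt H.aleph0_le (mk_Iio_lt k) hAκ))
  refine ⟨M, hMκ, fun N _ hN e β b hβ n c => ?_⟩
  obtain ⟨S, T, hS, hT⟩ := exists_small_support (χ := max ℵ₀ #β) (x := v) b (fun q => by
      obtain ⟨t, ht⟩ := hx (b q)
      refine ⟨t.relabel Subtype.val, ?_⟩
      rw [← ht]
      simp only [Term.realize_relabel]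
      congr 1
      funext s
      exact (hxv s).symm)
    (le_max_left _ _) (le_max_right _ _)
  obtain ⟨k, hk⟩ := exists_gt_of_small H.reg (hS.trans_lt (max_lt H.aleph0_lt hβ))
    fun s : S => (Sum.elim id Prod.fst s.1 : W)
  have hSk : S ⊆ lowVars k := fun s hs => hk ⟨s, hs⟩
  obtain ⟨i, hki, hi⟩ := hex k n
  -- Place `c` in the slots of stage `i`. No new type is possible there, so terms in the earlier
  -- variables realize the type of `c` over `lowVars k`, and these can be evaluated in `M`.
  let v' : W ⊕ (W × ℕ) → N := fun s => match s with
    | Sum.inl w => e (v (Sum.inl w))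
    | Sum.inr (j, m) => if j < i then e (v (Sum.inr (j, m))) else
        if h : m < n then c ⟨m, h⟩ else e (v (Sum.inr (j, m)))
  have hv'1 : ∀ s ∈ lev (Set.Iio i), v' s = e (v s) := by
    rintro (w | ⟨j, m⟩) hs
    · rfl
    · exact if_pos (inr_mem_lev.1 hs)
  have hv'2 : ∀ m : Fin n, v' (Sum.inr (i, m)) = c m := by
    intro m
    simp [v']
  have hlowlev : lowVars k ⊆ lev (Set.Iio i) :=
    lowVars_subset fun a ha => lt_of_lt_of_le ha hki
  have hd : diag (lev (Set.Iio i)) v' = diag (L := L) (lev (Set.Iio i)) v := by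
    rw [diag_eq_iff]
    have : (fun s : lev (Set.Iio i) => v' s) = fun s : lev (Set.Iio i) => e (v s) :=
      funext fun s => hv'1 s s.2
    rw [this]
    exact atp_map e fun s : lev (Set.Iio i) => v s
  have hnot : ¬ AddsType (L := L) k n i v' := fun h => hi ⟨⟨N, hN⟩, v', hd, h⟩
  unfold AddsType at hnot
  push Not at hnot
  obtain ⟨τ, hτ⟩ := hnot hki
  refine ⟨fun m => (τ m).realize fun s : lev (Set.Iio i) => v s, ?_⟩
  have h1 : (fun s : lowVars k => v' s) = fun s : lowVars k => e (v s) :=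
    funext fun s => hv'1 s (hlowlev s.2)
  have h2 : ∀ m, (τ m).realize (fun s : lev (Set.Iio i) => v' s) =
      e ((τ m).realize fun s : lev (Set.Iio i) => v s) := by
    intro m
    rw [← HomClass.realize_term (g := e)]
    congr 1
    exact funext fun s => hv'1 s s.2
  simp only [h1, h2, hv'2] at hτ
  have h3 : (Sum.elim (fun s : lowVars k => e (v s)) fun m => e ((τ m).realize
      fun s : lev (Set.Iio i) => v s)) = fun z => e (Sum.elim (fun s : lowVars k => v s)
      (fun m => (τ m).realize fun s : lev (Set.Iio i) => v s) z) := by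
    funext z
    rcases z with z | z <;> rfl
  rw [h3, atp_map] at hτ
  have h4 := atp_terms hτ.symm (V := β ⊕ Fin n) (Sum.elim
    (fun q => (T q).relabel fun s => Sum.inl (Set.inclusion hSk s)) fun m => Term.var (Sum.inr m))
  convert h4 using 2
  · funext z
    rcases z with q | m
    · simp only [Sum.elim_inl, Term.realize_relabel, hT]
      rfl
    · rfl
  · funext z
    rcases z with q | m
    · simp only [Sum.elim_inl, Term.realize_relabel, hT]
      rw [← HomClass.realize_term (g := e)]
      rfl
    · rfl

/-- Every model of cardinality `κ` realizes all types over small subsets that are realized in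
extensions. -/
theorem exists_realization_of_embedding {M N : Type u} [L.Structure M] [L.Structure N] (hM : K M)
    (hM' : #M = κ) (hN : K N) (e : M ↪[L] N) {β : Type u} (b : β → M) (hβ : #β < κ) {n : ℕ}
    (c : Fin n → N) : ∃ c' : Fin n → M,
      atp L (Sum.elim b c') = atp L (Sum.elim (fun i => e (b i)) c) := by
  obtain ⟨M₀, hM₀, h⟩ := H.exists_maximal
  obtain ⟨θ⟩ := H.exists_equiv hM M₀.mem hM' hM₀
  obtain ⟨c', hc'⟩ := h N hN (e.comp θ.symm.toEmbedding) β (fun i => θ (b i)) hβ n c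
  refine ⟨fun m => θ.symm (c' m), ?_⟩
  have h1 : Sum.elim b (fun m => θ.symm (c' m)) =
      fun z => θ.symm.toEmbedding (Sum.elim (fun i => θ (b i)) c' z) := by
    funext z
    rcases z with z | z
    · simp
    · rfl
  rw [h1, atp_map, hc']
  congr 2
  funext i
  simp

end IsCategoricalClass

/-! ### Values of one term at disjoint tuples of a basis -/

section delta

variable {W M : Type u} [L.Structure M]

/-- The elements of `X` that are values of the term `t` with parameters in the family `x` at
injective tuples avoiding `S`. -/
def termValues (x : W → M) (X : Set M) {n : ℕ} (t : L.Term (W ⊕ Fin n)) (S : Set W) : Set M :=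
  {a | a ∈ X ∧ ∃ s : Fin n → W, Function.Injective s ∧ (∀ i, s i ∉ S) ∧
    t.realize (x ∘ Sum.elim id s) = a}

/-- Take the least arity that yields more than χ values in `X`. Arguments meeting `S` can be
discarded, since fixing one coordinate at an element of `S` lowers the arity and leaves at most χ
values. -/
theorem exists_termValues {x : W → M} (hx : Generates L x) {X : Set M} {χ : Cardinal.{u}}
    (hχ : L.card + ℵ₀ ≤ χ) (hX : χ < #X) :
    ∃ (n : ℕ) (t : L.Term (W ⊕ Fin n)), ∀ S : Set W, #S ≤ χ → χ < #(termValues x X t S) := by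
  classical
  have hχ₀ : ℵ₀ ≤ χ := le_trans le_add_self hχ
  have hex : ∃ n, ∃ t : L.Term (W ⊕ Fin n), χ < #(termValues x X t ∅) := by
    by_contra hcon
    push Not at hcon
    have hsub : X ⊆ ⋃ q : Σ n, L.Term (Fin n), termValues x X (q.2.relabel Sum.inr) ∅ := by
      intro a ha
      obtain ⟨m, g, t, hg, ht⟩ := exists_common_support (x := x) (fun _ : Fin 1 => a)
        (fun _ => hx _)
      refine Set.mem_iUnion.2 ⟨⟨m, t 0⟩, ha, g, hg, fun _ h => h, ?_⟩
      rw [Term.realize_relabel]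
      exact (ht 0).symm
    have h1 := mk_iUnion_le' hχ₀ (s := fun q : Σ n, L.Term (Fin n) =>
      termValues x X (q.2.relabel (Sum.inr (α := W))) ∅)
      (mk_sigma_nat_le hχ₀ fun m => mk_term_fin_le hχ m) (fun q => hcon _ _)
    exact absurd ((Cardinal.mk_le_mk_of_subset hsub).trans h1) (not_le.2 hX)
  obtain ⟨t, ht⟩ := Nat.find_spec hex
  refine ⟨Nat.find hex, t, fun S hS => ?_⟩
  by_contra hle
  rw [not_lt] at hle
  have hmin := fun m (hm : m < Nat.find hex) => Nat.find_min hex hm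
  revert t hmin
  generalize Nat.find hex = n
  intro t ht hle hmin
  have hbad : #(⋃ q : ULift.{u} (Fin n) × S, {a | a ∈ X ∧ ∃ s : Fin n → W,
      Function.Injective s ∧ s q.1.down = q.2 ∧ t.realize (x ∘ Sum.elim id s) = a} : Set M) ≤ χ := by
    refine mk_iUnion_le' hχ₀ (mk_prod_le hχ₀ (mk_finite_le hχ₀ _) hS) ?_
    rintro ⟨⟨k⟩, u⟩
    rcases n with _ | n
    · exact k.elim0
    by_contra hlt
    rw [not_le] at hlt
    refine hmin n (Nat.lt_succ_self n) ⟨t.relabel (Sum.elim Sum.inl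
      (k.insertNth (α := fun _ => W ⊕ Fin n) (Sum.inl (u : W)) Sum.inr)),
      lt_of_lt_of_le hlt (Cardinal.mk_le_mk_of_subset ?_)⟩
    rintro a ⟨ha, s, hs, hsk, hta⟩
    refine ⟨ha, s ∘ k.succAbove, hs.comp Fin.succAbove_right_injective, fun _ h => h, ?_⟩
    rw [← hta, Term.realize_relabel]
    congr 1
    funext v
    rcases v with w | i
    · rfl
    · rcases Fin.eq_self_or_eq_succAbove k i with rfl | ⟨j, rfl⟩
      · simp [hsk]
      · simp
  have hsub : termValues x X t ∅ ⊆ termValues x X t S ∪ ⋃ q : ULift.{u} (Fin n) × S,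
      {a | a ∈ X ∧ ∃ s : Fin n → W, Function.Injective s ∧ s q.1.down = q.2 ∧
        t.realize (x ∘ Sum.elim id s) = a} := by
    rintro a ⟨ha, s, hs, -, hta⟩
    by_cases h : ∀ i, s i ∉ S
    · exact Or.inl ⟨ha, s, hs, h, hta⟩
    · push Not at h
      obtain ⟨i, hi⟩ := h
      exact Or.inr (Set.mem_iUnion.2 ⟨(⟨i⟩, ⟨s i, hi⟩), ha, s, hs, rfl, hta⟩)
  have h2 := ((Cardinal.mk_le_mk_of_subset hsub).trans (Cardinal.mk_union_le _ _)).trans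
    ((add_le_add hle hbad).trans (Cardinal.add_eq_self hχ₀).le)
  exact absurd h2 (not_le.2 ht)

/-- The value of a term with parameters in `R` at a tuple. -/
def dval (x : W → M) {R : Set W} {n : ℕ} (t : L.Term (R ⊕ Fin n)) (s : Fin n → W) : M :=
  t.realize (x ∘ Sum.elim Subtype.val s)

/-- Families of values of a term at disjoint tuples are indiscernible over the span of the
parameters. -/
theorem IsBasis.atp_dval {x : W → M} (hx : IsBasis L x) {R : Set W} {n : ℕ} (t : L.Term (R ⊕ Fin n))
    {β : Type*} {b : β → M} (hb : ∀ p, b p ∈ span L (fun r : R => x r)) {J : Type*}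
    {f f' : J → Fin n → W} (hf : Function.Injective fun q : J × Fin n => f q.1 q.2)
    (hf' : Function.Injective fun q : J × Fin n => f' q.1 q.2) (hR : ∀ j i, f j i ∉ R)
    (hR' : ∀ j i, f' j i ∉ R) :
    atp L (Sum.elim b fun j => dval x t (f j)) = atp L (Sum.elim b fun j => dval x t (f' j)) := by
  choose T hT using hb
  have hT : ∀ p, (T p).realize (fun r : R => x r) = b p := hT
  have hinj : ∀ {f : J → Fin n → W}, (Function.Injective fun q : J × Fin n => f q.1 q.2) →
      (∀ j i, f j i ∉ R) →
      Function.Injective (Sum.elim (Subtype.val : R → W) fun q : J × Fin n => f q.1 q.2) := by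
    intro f hf hR
    refine Subtype.val_injective.sumElim hf ?_
    rintro r ⟨j, i⟩ h
    exact hR j i (h ▸ r.2)
  have h1 := atp_terms (hx.atp_eq (hinj hf hR) (hinj hf' hR')) (V := β ⊕ J)
    (Sum.elim (fun p => (T p).relabel Sum.inl)
      fun j => t.relabel (Sum.map id fun i => (j, i)))
  have e : ∀ f : J → Fin n → W, (fun v => (Sum.elim (fun p => (T p).relabel Sum.inl)
      (fun j => t.relabel (Sum.map id fun i => (j, i))) v : L.Term (R ⊕ J × Fin n)).realize
      (x ∘ Sum.elim (Subtype.val : R → W) fun q : J × Fin n => f q.1 q.2)) =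
      Sum.elim b fun j => dval x t (f j) := by
    intro f
    funext v
    rcases v with p | j
    · simp only [Sum.elim_inl, Term.realize_relabel, ← hT]
      rfl
    · simp only [Sum.elim_inr, Term.realize_relabel, dval]
      congr 1
      funext z
      rcases z with z | z <;> rfl
  rw [e, e] at h1
  exact h1

/-- Every large set contains an infinite sequence of values of a term at disjoint tuples. -/
theorem IsBasis.exists_dval {x : W → M} (hx : IsBasis L x) {X : Set M} {χ : Cardinal.{u}}
    (hχ : L.card + ℵ₀ ≤ χ) (hX : χ < #X) {S : Set W} (hS : #S ≤ χ) :
    ∃ (R : Set W) (n : ℕ) (t : L.Term (R ⊕ Fin n)), S ⊆ R ∧ #R ≤ χ ∧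
      (∀ s s' : Fin n → W, Function.Injective (Sum.elim s s') → (∀ i, s i ∉ R) →
        (∀ i, s' i ∉ R) → dval x t s ≠ dval x t s') ∧
      ∃ s : ℕ → Fin n → W, (Function.Injective fun q : ℕ × Fin n => s q.1 q.2) ∧
        (∀ k i, s k i ∉ R) ∧ ∀ k, dval x t (s k) ∈ X := by
  classical
  have hχ₀ : ℵ₀ ≤ χ := le_trans le_add_self hχ
  obtain ⟨n, t₀, ht₀⟩ := exists_termValues hx.generates hχ hX
  obtain ⟨F, hF⟩ := exists_finset_term t₀
  let R : Set W := S ∪ {w | Sum.inl w ∈ F}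
  have hR : #R ≤ χ := by
    refine (Cardinal.mk_union_le _ _).trans ((add_le_add hS ?_).trans (Cardinal.add_eq_self hχ₀).le)
    have : Finite {w : W | Sum.inl w ∈ F} :=
      (F.finite_toSet.preimage Sum.inl_injective.injOn).to_subtype
    exact mk_finite_le hχ₀ _
  have ht : ∃ t : L.Term (R ⊕ Fin n), t.relabel (Sum.map Subtype.val id) = t₀ := by
    obtain ⟨t', ht'⟩ := hF (Set.range (Sum.map (Subtype.val : R → W) (id : Fin n → Fin n))) (by
      rintro (w | i) hv
      · exact ⟨Sum.inl ⟨w, Or.inr hv⟩, rfl⟩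
      · exact ⟨Sum.inr i, rfl⟩)
    refine ⟨t'.relabel fun v => v.2.choose, ?_⟩
    rw [Term.relabel_relabel, ← ht']
    congr 1
    funext v
    exact v.2.choose_spec
  obtain ⟨t, ht⟩ := ht
  have hval : ∀ s : Fin n → W, t₀.realize (x ∘ Sum.elim id s) = dval x t s := by
    intro s
    rw [← ht, Term.realize_relabel, dval]
    congr 1
    funext v
    rcases v with v | v <;> rfl
  have hnext : ∀ (T : Set W) (a : M), #T ≤ χ → ∃ s : Fin n → W, Function.Injective s ∧
      (∀ i, s i ∉ R) ∧ (∀ i, s i ∉ T) ∧ dval x t s ∈ X ∧ dval x t s ≠ a := by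
    intro T a hT
    have h1 := ht₀ (R ∪ T) ((Cardinal.mk_union_le _ _).trans
      ((add_le_add hR hT).trans (Cardinal.add_eq_self hχ₀).le))
    have h2 : ∃ a' ∈ termValues x X t₀ (R ∪ T), a' ≠ a := by
      by_contra h
      push Not at h
      have h3 := (Cardinal.mk_le_mk_of_subset (show termValues x X t₀ (R ∪ T) ⊆ {a} from h)).trans
        (mk_finite_le hχ₀ _)
      exact absurd h3 (not_le.2 h1)
    obtain ⟨_, ⟨ha', s, hs, hsR, rfl⟩, hne⟩ := h2
    rw [hval] at ha' hne
    exact ⟨s, hs, fun i h => hsR i (Or.inl h), fun i h => hsR i (Or.inr h), ha', hne⟩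
  have hfin : ∀ s : Fin n → W, #(Set.range s) ≤ χ := fun s => mk_finite_le hχ₀ _
  have hpair : ∀ {s s' : Fin n → W}, Function.Injective s → Function.Injective s' →
      (∀ i, s' i ∉ Set.range s) → Function.Injective (Sum.elim s s') := fun {s s'} h h' hd =>
    h.sumElim h' fun a b e => hd b ⟨a, e⟩
  refine ⟨R, n, t, Set.subset_union_left, hR, ?_, ?_⟩
  -- All pairs of disjoint tuples off `R` look alike, and `hnext` gives one such pair with different
  -- values; so every such pair has different values.
  · intro s s' hss hs hs' he
    obtain ⟨s₁, h1, h2, -, -, -⟩ := hnext ∅ (dval x t s) (by simp)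
    obtain ⟨s₂, h3, h4, h5, -, h6⟩ := hnext (Set.range s₁) (dval x t s₁) (hfin s₁)
    have hJ : ∀ {s s' : Fin n → W}, Function.Injective (Sum.elim s s') →
        Function.Injective fun q : Bool × Fin n => (cond q.1 s s') q.2 := by
      intro s s' h
      rintro ⟨_ | _, i⟩ ⟨_ | _, j⟩ hij
      · rw [Sum.inr.inj (h (a₁ := Sum.inr i) (a₂ := Sum.inr j) hij)]
      · exact nomatch h (a₁ := Sum.inr i) (a₂ := Sum.inl j) hij
      · exact nomatch h (a₁ := Sum.inl i) (a₂ := Sum.inr j) hij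
      · rw [Sum.inl.inj (h (a₁ := Sum.inl i) (a₂ := Sum.inl j) hij)]
    have h7 := hx.atp_dval t (b := (Empty.elim : Empty → M)) (fun p => p.elim)
      (f := fun c : Bool => cond c s s') (f' := fun c : Bool => cond c s₁ s₂)
      (hJ hss) (hJ (hpair h1 h3 h5)) (by rintro (_ | _) <;> assumption)
      (by rintro (_ | _) <;> assumption)
    exact h6 ((atp_eq_iff_apply h7 (Sum.inr true) (Sum.inr false)).1 he).symm
  · obtain ⟨s, hs1, hs2⟩ := exists_seq_of_forall_finset_exists
      (fun s : Fin n → W => Function.Injective s ∧ (∀ i, s i ∉ R) ∧ dval x t s ∈ X)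
      (fun s s' => ∀ i, s' i ∉ Set.range s) (by
        intro G _
        obtain ⟨a₀⟩ : Nonempty X := Cardinal.mk_ne_zero_iff.1 (pos_of_gt hX).ne'
        obtain ⟨s, h1, h2, h3, h4, -⟩ := hnext (⋃ s ∈ G, Set.range s)
          a₀.1
          (by
            have : Finite (⋃ s ∈ G, Set.range s) := (G.finite_toSet.biUnion fun s _ =>
              Set.finite_range s).to_subtype
            exact mk_finite_le hχ₀ _)
        exact ⟨s, ⟨h1, h2, h4⟩, fun s' hs' i hi => h3 i (Set.mem_biUnion hs' hi)⟩)
    refine ⟨s, ?_, fun k => (hs1 k).2.1, fun k => (hs1 k).2.2⟩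
    rintro ⟨k, i⟩ ⟨l, j⟩ h
    have h : s k i = s l j := h
    rcases lt_trichotomy k l with hkl | rfl | hkl
    · exact absurd ⟨i, h⟩ (hs2 k l hkl j)
    · rw [(hs1 k).1 h]
    · exact absurd ⟨j, h.symm⟩ (hs2 l k hkl i)

end delta

/-! ### Saturation of large substructures -/

theorem exists_term_finset_right {β J : Type*} (τ : L.Term (β ⊕ J)) :
    ∃ (F : Finset J) (τ' : L.Term (β ⊕ F)), τ'.relabel (Sum.map id Subtype.val) = τ := by
  classical
  obtain ⟨G, hG⟩ := exists_finset_term τ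
  obtain ⟨τ', hτ'⟩ := hG (Set.range (Sum.map (id : β → β) (Subtype.val : G.toRight → J))) (by
    rintro (p | j) hv
    · exact ⟨Sum.inl p, rfl⟩
    · exact ⟨Sum.inr ⟨j, Finset.mem_toRight.2 hv⟩, rfl⟩)
  refine ⟨G.toRight, τ'.relabel fun v => v.2.choose, ?_⟩
  rw [Term.relabel_relabel, ← hτ']
  congr 1
  funext v
  exact v.2.choose_spec

theorem exists_finset_atp_ne {β γ : Type*} {M N : Type u} [L.Structure M] [L.Structure N]
    {b : β → M} {b' : β → N} {c : γ → M} {c' : γ → N}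
    (h : atp L (Sum.elim b c) ≠ atp L (Sum.elim b' c')) :
    ∃ F : Finset β, atp L (Sum.elim (fun p : F => b p) c) ≠
      atp L (Sum.elim (fun p : F => b' p) c') := by
  classical
  by_contra hcon
  push Not at hcon
  refine h (atp_eq_of_finite fun G => ?_)
  have h1 := atp_comp (hcon G.toLeft) (fun v : G => match v with
    | ⟨Sum.inl p, hp⟩ => Sum.inl ⟨p, Finset.mem_toLeft.2 hp⟩
    | ⟨Sum.inr q, _⟩ => Sum.inr q)
  convert h1 using 2
  · funext v
    rcases v with ⟨v | v, hv⟩ <;> rfl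
  · funext v
    rcases v with ⟨v | v, hv⟩ <;> rfl

/-- A small set closed under a finitary operation. -/
theorem exists_closed_set {X : Type u} {χ : Cardinal.{u}} (hχ : ℵ₀ ≤ χ) (G : Finset X → Set X)
    (hG : ∀ F, #(G F) ≤ χ) : ∃ B : Set X, #B ≤ χ ∧ ∀ F : Finset X, ↑F ⊆ B → G F ⊆ B := by
  classical
  let B : ℕ → Set X := fun n => Nat.rec (motive := fun _ => Set X) ∅
    (fun _ B => B ∪ ⋃ F : {F : Finset X // (F : Set X) ⊆ B}, G F.1) n
  have hsucc : ∀ n, B (n + 1) = B n ∪ ⋃ F : {F : Finset X // (F : Set X) ⊆ B n}, G F.1 := fun n => rfl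
  have hmono : Monotone B := monotone_nat_of_le_succ fun n => by
    rw [hsucc]
    exact Set.subset_union_left
  have hB : ∀ n, #(B n) ≤ χ := by
    intro n
    induction n with
    | zero =>
      change #(∅ : Set X) ≤ χ
      simp
    | succ n ih =>
      rw [hsucc]
      refine (Cardinal.mk_union_le _ _).trans ((add_le_add ih (mk_iUnion_le' hχ ?_
        fun F : {F : Finset X // (F : Set X) ⊆ B n} => hG F.1)).trans (Cardinal.add_eq_self hχ).le)
      refine (Cardinal.mk_le_of_injective (f := fun F : {F : Finset X // (F : Set X) ⊆ B n} =>
        F.1.subtype (· ∈ B n)) ?_).trans (le_trans (b := #(Finset (B n))) le_rfl ?_)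
      · intro F F' h
        refine Subtype.ext (Finset.ext fun a => ?_)
        have h1 := fun ha => Finset.ext_iff.1 h ⟨a, ha⟩
        simp only [Finset.mem_subtype] at h1
        exact ⟨fun ha => (h1 (F.2 ha)).1 ha, fun ha => (h1 (F'.2 ha)).2 ha⟩
      · rcases finite_or_infinite (B n) with hf | hf
        · exact mk_finite_le hχ _
        · rw [Cardinal.mk_finset_of_infinite]
          exact ih
  refine ⟨⋃ n : ULift.{u} ℕ, B n.down, mk_iUnion_le' hχ (by simpa using hχ) fun n => hB _, ?_⟩
  intro F hF
  have h1 : ∃ n, (F : Set X) ⊆ B n := by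
    induction F using Finset.induction_on with
    | empty => exact ⟨0, by simp⟩
    | insert a F _ ih =>
      rw [Finset.coe_insert, Set.insert_subset_iff] at hF
      obtain ⟨n, hn⟩ := ih hF.2
      obtain ⟨⟨m⟩, hm⟩ := Set.mem_iUnion.1 hF.1
      refine ⟨max m n, ?_⟩
      rw [Finset.coe_insert, Set.insert_subset_iff]
      exact ⟨hmono (le_max_left m n) hm, hn.trans (hmono (le_max_right m n))⟩
  obtain ⟨n, hn⟩ := h1
  intro a ha
  refine Set.mem_iUnion.2 ⟨⟨n + 1⟩, ?_⟩
  change a ∈ B (n + 1)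
  rw [hsucc]
  exact Or.inr (Set.mem_iUnion.2 ⟨⟨F, hn⟩, ha⟩)

theorem injective_of_tuples {W M J : Type*} {n : ℕ} {f : J → Fin n → M} {R : Set M}
    {d : (Fin n → M) → W} (hf : Function.Injective fun q : J × Fin n => f q.1 q.2)
    (hR : ∀ j i, f j i ∉ R)
    (hd : ∀ s s' : Fin n → M, Function.Injective (Sum.elim s s') → (∀ i, s i ∉ R) →
      (∀ i, s' i ∉ R) → d s ≠ d s') : Function.Injective fun j => d (f j) := by
  intro j j' h
  by_contra hne
  refine hd _ _ ?_ (hR j) (hR j') h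
  refine Function.Injective.sumElim ?_ ?_ ?_
  · intro i i' hi
    exact (Prod.mk.inj (hf (a₁ := (j, i)) (a₂ := (j, i')) hi)).2
  · intro i i' hi
    exact (Prod.mk.inj (hf (a₁ := (j', i)) (a₂ := (j', i')) hi)).2
  · intro i i' hi
    exact hne (Prod.mk.inj (hf (a₁ := (j, i)) (a₂ := (j', i')) hi)).1

namespace IsCategoricalClass

variable {κ : Cardinal.{u}} (H : IsCategoricalClass K κ)

include H

theorem exists_tuples {T : Set κ.ord.ToType} (hT : #T < κ) {J : Type u} (hJ : #J ≤ κ) (n : ℕ) :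
    ∃ f : J → Fin n → κ.ord.ToType, (Function.Injective fun q : J × Fin n => f q.1 q.2) ∧
      ∀ j i, f j i ∉ T := by
  have hW : #κ.ord.ToType = κ := by simp
  have : Infinite κ.ord.ToType := Cardinal.infinite_iff.2 (hW.symm ▸ H.aleph0_le)
  have h1 : #(Tᶜ : Set κ.ord.ToType) = κ :=
    (Cardinal.mk_compl_of_infinite T (hT.trans_eq hW.symm)).trans hW
  have h2 : #(J × ULift.{u} (Fin n)) ≤ #(Tᶜ : Set κ.ord.ToType) := by
    rw [h1]
    exact mk_prod_le H.aleph0_le hJ (mk_finite_le H.aleph0_le _)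
  obtain ⟨f⟩ := h2
  refine ⟨fun j i => f (j, ⟨i⟩), ?_, fun j i => (f (j, ⟨i⟩)).2⟩
  rintro ⟨j, i⟩ ⟨j', i'⟩ h
  have h3 := Prod.mk.inj (f.injective (Subtype.ext h))
  exact Prod.ext h3.1 (ULift.up_injective h3.2)

theorem mk_span_eq {M : Type u} [L.Structure M] {I : Type u} (x : I → M) (hI : #I ≤ κ) {J : Type u}
    (hJ : #J = κ) {g : J → I} (hg : Function.Injective fun j => x (g j)) : #(span L x) = κ := by
  refine le_antisymm ?_ ?_
  · exact (card_span_le x).trans ((add_le_add hI H.lt.le).trans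
      (Cardinal.add_eq_self H.aleph0_le).le)
  · rw [← hJ]
    exact Cardinal.mk_le_of_injective (f := fun j => toSpan L x (g j)) fun a b h =>
      hg (congrArg Subtype.val h)

/-- Substructures of models of cardinality `κ` are saturated. -/
theorem exists_realization_mem {M : Type u} [L.Structure M] (hM : K M) (hM' : #M = κ)
    (A : L.Substructure M) {χ : Cardinal.{u}} (hχ : L.card + ℵ₀ ≤ χ) (hA : χ < #A) {β : Type u}
    (b : β → M) (hb : ∀ p, b p ∈ A) (hβ : #β ≤ χ) (c : Fin 1 → M) :
    ∃ a ∈ A, atp L (Sum.elim b fun _ : Fin 1 => a) = atp L (Sum.elim b c) := by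
  classical
  by_contra hcon
  push Not at hcon
  have hχ₀ : ℵ₀ ≤ χ := le_trans le_add_self hχ
  have hχκ : χ < κ := hA.trans_le ((Cardinal.mk_subtype_le _).trans hM'.le)
  obtain ⟨x, hx⟩ := H.exists_isBasis hM hM'
  obtain ⟨S, T, hS, hT⟩ := exists_small_support (x := x) b (fun p => hx.generates _) hχ₀ hβ
  obtain ⟨R, n, t, hSR, hR, hd, s, hs, hsR, hsA⟩ := hx.exists_dval (X := (A : Set M)) hχ hA hS
  have hbR : ∀ p, b p ∈ span L (fun r : R => x r) := by
    intro p
    refine ⟨(T p).relabel (Set.inclusion hSR), ?_⟩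
    simp only [Term.realize_relabel]
    exact (hT p).symm
  -- Each `a` in `A` fails to realize the type of `c` already over finitely many parameters.
  have hF : ∀ a : A, ∃ F : Finset β, atp L (Sum.elim (fun p : F => b p) fun _ : Fin 1 => (a : M)) ≠
      atp L (Sum.elim (fun p : F => b p) c) := fun a => exists_finset_atp_ne (hcon a a.2)
  choose F hF using hF
  have hmem : ∀ {γ : Type u} (i : γ → β) (τ : L.Term (γ ⊕ ℕ)),
      τ.realize (Sum.elim (fun p => b (i p)) fun k => dval x t (s k)) ∈ A := fun i τ =>
    τ.realize_mem _ (by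
      rintro (p | k)
      · exact hb _
      · exact hsA k)
  -- `B` is closed under taking the failure sets `F` of all term values built from its members and
  -- the sequence in `A`.
  obtain ⟨B, hB, hBcl⟩ := exists_closed_set (χ := L.card + ℵ₀) le_add_self
    (fun G : Finset β => ⋃ τ : L.Term (G ⊕ ℕ), (F ⟨_, hmem Subtype.val τ⟩ : Set β)) (fun G =>
      mk_iUnion_le' le_add_self (mk_term_le_of_le le_rfl (by
        have : #(↥G ⊕ ℕ) = #(G ⊕ ULift.{u} ℕ) := Cardinal.mk_congr
          (Equiv.sumCongr (Equiv.refl _) Equiv.ulift.symm)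
        rw [this]
        exact mk_sum_le le_add_self (mk_finite_le le_add_self _) (by simp)))
        fun τ => mk_finite_le le_add_self _)
  -- Stretch the sequence to κ disjoint tuples. Together with `B` its values span a model of size κ,
  -- which realizes the type of `c` over `B`.
  obtain ⟨f, hf, hfR⟩ := H.exists_tuples (hR.trans_lt hχκ) (J := κ.ord.ToType) (by simp) n
  let b' : B → M := fun p => b p
  let y : B ⊕ κ.ord.ToType → M := Sum.elim b' fun j => dval x t (f j)
  have hinj : Function.Injective fun j => dval x t (f j) := 
    injective_of_tuples (d := dval x t) hf hfR hd
  have hBκ : #B < κ := hB.trans_lt H.lt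
  have hN : #(span L y) = κ := H.mk_span_eq y (mk_sum_le H.aleph0_le hBκ.le (by simp))
    (by simp) (g := Sum.inr) hinj
  have : Nonempty κ.ord.ToType := Cardinal.nonempty_ord_toType H.reg.pos.ne'
  obtain ⟨c', hc'⟩ := H.exists_realization_of_embedding (H.univ.span_mem hM y) hN hM
    (span L y).subtype (fun p : B => toSpan L y (Sum.inl p)) hBκ c
  obtain ⟨τ, hτ⟩ := (c' 0).2
  have hτ : τ.realize y = c' 0 := hτ
  obtain ⟨J, τ', rfl⟩ := exists_term_finset_right τ
  rw [Term.realize_relabel] at hτ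
  let h : J → ℕ := fun j => J.equivFin j
  have hh : Function.Injective h := Fin.val_injective.comp J.equivFin.injective
  -- The realization involves finitely many stretched values. Replacing them by values of the
  -- original sequence yields an element of `A` with the same type over `B`, whose failure set lies
  -- in `B`: a contradiction.
  have key := hx.atp_dval t (b := b') (fun p => hbR p) (J := J) (f := fun j => f j)
    (f' := fun j => s (h j))
    (fun q q' hq => by
      have := Prod.mk.inj (hf (a₁ := (q.1.1, q.2)) (a₂ := (q'.1.1, q'.2)) hq)
      exact Prod.ext (Subtype.ext this.1) this.2)
    (fun q q' hq => by
      have := Prod.mk.inj (hs (a₁ := (h q.1, q.2)) (a₂ := (h q'.1, q'.2)) hq)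
      exact Prod.ext (hh this.1) this.2) (fun j => hfR j) (fun j => hsR _)
  have h1 := atp_terms key (V := B ⊕ Fin 1)
    (Sum.elim (fun p => Term.var (Sum.inl p)) fun _ => τ')
  let a : M := τ'.realize (Sum.elim b' fun j : J => dval x t (s (h j)))
  have h2 : atp L (Sum.elim b' fun _ : Fin 1 => a) = atp L (Sum.elim b' c) := by
    have e1 : (fun v => (Sum.elim (fun p => Term.var (Sum.inl p)) (fun _ => τ') v :
        L.Term (B ⊕ J)).realize (Sum.elim b' fun j : J => dval x t (s (h j)))) =
        Sum.elim b' fun _ : Fin 1 => a := by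
      funext v
      rcases v with v | v <;> rfl
    have e2 : (fun v => (Sum.elim (fun p => Term.var (Sum.inl p)) (fun _ => τ') v :
        L.Term (B ⊕ J)).realize (Sum.elim b' fun j : J => dval x t (f j))) =
        fun v => ((Sum.elim (fun p : B => toSpan L y (Sum.inl p)) c' v : span L y) : M) := by
      funext v
      rcases v with v | v
      · rfl
      · rw [Subsingleton.elim v 0]
        refine Eq.trans ?_ hτ
        simp only [Sum.elim_inr]
        congr 1
        funext z
        rcases z with z | z <;> rfl
    rw [e1, e2] at h1
    rw [← h1, atp_coe, hc']
    rfl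
  obtain ⟨P, τ₂, hτ₂⟩ := exists_term_finset_right (τ'.relabel Sum.swap)
  let Q : Finset β := P.map (Function.Embedding.subtype _)
  let ρ : J ⊕ P → Q ⊕ ℕ := Sum.elim (fun j => Sum.inr (h j))
    fun p => Sum.inl ⟨p.1.1, Finset.mem_map_of_mem _ p.2⟩
  have ha : (τ₂.relabel ρ).realize (Sum.elim (fun p : Q => b p) fun k => dval x t (s k)) = a := by
    have h3 : a = (τ'.relabel Sum.swap).realize
        (Sum.elim (fun j : J => dval x t (s (h j))) b') := by
      rw [Term.realize_relabel]
      simp only [a]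
      congr 1
      funext z
      rcases z with z | z <;> rfl
    rw [h3, ← hτ₂, Term.realize_relabel, Term.realize_relabel]
    congr 1
    funext z
    rcases z with z | z <;> rfl
  have haA : a ∈ A := ha ▸ hmem Subtype.val (τ₂.relabel ρ)
  have hFB : (F ⟨a, haA⟩ : Set β) ⊆ B := by
    refine Set.Subset.trans ?_ (hBcl Q (by
      intro p hp
      obtain ⟨p', -, rfl⟩ := Finset.mem_map.1 (Finset.mem_coe.1 hp)
      exact p'.2))
    refine Set.Subset.trans ?_ (Set.subset_iUnion _ (τ₂.relabel ρ))
    simp only [ha]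
    exact subset_rfl
  refine hF ⟨a, haA⟩ ?_
  have h4 := atp_comp h2 (V := F ⟨a, haA⟩ ⊕ Fin 1) (Sum.map (fun p => ⟨p, hFB p.2⟩) id)
  convert h4 using 2
  · funext v
    rcases v with v | v <;> rfl
  · funext v
    rcases v with v | v <;> rfl

end IsCategoricalClass

/-! ### Averages of sequences in a substructure -/

theorem IsBasis.equiv {W M N : Type u} [L.Structure M] [L.Structure N] {x : W → M}
    (hx : IsBasis L x) (θ : M ≃[L] N) : IsBasis L fun w => θ (x w) := by
  refine ⟨fun m => ?_, θ.injective.comp hx.injective, fun n g g' hg hg' => ?_⟩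
  · obtain ⟨t, ht⟩ := hx.generates (θ.symm m)
    refine ⟨t, ?_⟩
    have h1 := HomClass.realize_term (g := θ) (t := t) (v := x)
    rw [ht] at h1
    simpa [Function.comp_def] using h1
  · exact (atp_map θ.toEmbedding (x ∘ g)).trans
      ((hx.indisc n g g' hg hg').trans (atp_map θ.toEmbedding (x ∘ g')).symm)

namespace IsCategoricalClass

variable {κ : Cardinal.{u}} (H : IsCategoricalClass K κ)

include H

theorem exists_isBasis_atp_eq {M₀ M : Type u} [L.Structure M₀] [L.Structure M] (hM₀ : K M₀)
    (hM₀' : #M₀ = κ) (hM : K M) (hM' : #M = κ) {x₀ : κ.ord.ToType → M₀} (hx₀ : IsBasis L x₀) :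
    ∃ x : κ.ord.ToType → M, IsBasis L x ∧ atp L x = atp L x₀ := by
  obtain ⟨θ⟩ := H.exists_equiv hM₀ hM hM₀' hM'
  exact ⟨_, hx₀.equiv θ, atp_map θ.toEmbedding x₀⟩

/-- Some submodel of cardinality `κ` has a basis with a prescribed countable part in the given
substructure. -/
theorem exists_isBasis_mem {M₀ M : Type u} [L.Structure M₀] [L.Structure M] (hM₀ : K M₀)
    (hM₀' : #M₀ = κ) (hM : K M) (hM' : #M = κ) {x₀ : κ.ord.ToType → M₀} (hx₀ : IsBasis L x₀)
    (A : L.Substructure M) (hA : L.card + ℵ₀ < #A) (ι : ℕ → κ.ord.ToType) :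
    ∃ (N : L.Substructure M) (z : κ.ord.ToType → N), K N ∧ #N = κ ∧ IsBasis L z ∧
      atp L z = atp L x₀ ∧ ∀ k, (z (ι k) : M) ∈ A := by
  classical
  have hW : #κ.ord.ToType = κ := by simp
  have : Nonempty κ.ord.ToType := Cardinal.nonempty_ord_toType H.reg.pos.ne'
  obtain ⟨x, hx⟩ := H.exists_isBasis hM hM'
  obtain ⟨R, n, t, -, hR, hd, s, hs, hsR, hsA⟩ := hx.exists_dval (X := (A : Set M)) le_rfl hA
    (S := ∅) (by simp)
  let T : Set κ.ord.ToType := R ∪ Set.range fun q : ULift.{u} (ℕ × Fin n) => s q.down.1 q.down.2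
  have hT : #T < κ := by
    refine lt_of_le_of_lt ((Cardinal.mk_union_le _ _).trans ((add_le_add hR ?_).trans
      (Cardinal.add_eq_self le_add_self).le)) H.lt
    refine Cardinal.mk_range_le.trans (le_trans ?_ le_add_self)
    exact Cardinal.mk_le_aleph0
  obtain ⟨g, hg, hgT⟩ := H.exists_tuples hT (J := κ.ord.ToType) hW.le n
  let f : ULift.{u} ℕ ⊕ κ.ord.ToType → Fin n → κ.ord.ToType := Sum.elim (fun k => s k.down) g
  have hf : Function.Injective fun q : (ULift.{u} ℕ ⊕ κ.ord.ToType) × Fin n => f q.1 q.2 := by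
    rintro ⟨k | w, i⟩ ⟨l | w', j⟩ h
    · have h1 := Prod.mk.inj (hs (a₁ := (k.down, i)) (a₂ := (l.down, j)) h)
      rw [ULift.ext _ _ h1.1, h1.2]
    · exact absurd (Or.inr ⟨⟨(k.down, i)⟩, h⟩) (hgT w' j)
    · exact absurd (Or.inr ⟨⟨(l.down, j)⟩, h.symm⟩) (hgT w i)
    · have h1 := Prod.mk.inj (hg (a₁ := (w, i)) (a₂ := (w', j)) h)
      rw [h1.1, h1.2]
  have hfR : ∀ j i, f j i ∉ R := by
    rintro (k | w) i
    · exact hsR _ _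
    · exact fun h => hgT w i (Or.inl h)
  have hJ : #(ULift.{u} ℕ ⊕ κ.ord.ToType) ≤ κ :=
    mk_sum_le H.aleph0_le (by simpa using H.aleph0_le) hW.le
  have hinj := injective_of_tuples (d := dval x t) hf hfR hd
  let y : ULift.{u} ℕ ⊕ κ.ord.ToType → M := fun j => dval x t (f j)
  have hN₁ : #(span L y) = κ := H.mk_span_eq y hJ hW (g := Sum.inr)
    (hinj.comp Sum.inr_injective)
  obtain ⟨z, hz, hzx⟩ := H.exists_isBasis_atp_eq hM₀ hM₀' (H.univ.span_mem hM y) hN₁ hx₀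
  obtain ⟨S, τ, hS, hτ⟩ := exists_small_support (x := y) (fun k : ULift.{u} ℕ => (z (ι k.down) : M))
    (fun k => (z (ι k.down)).2) le_rfl (by simp)
  obtain ⟨enc⟩ : Nonempty (S ↪ ULift.{u} ℕ) :=
    by
    have h1 : #S ≤ #(ULift.{u} ℕ) := by
      rw [Cardinal.mk_uLift, Cardinal.mk_nat, Cardinal.lift_aleph0]
      exact hS
    exact h1
  obtain ⟨enc'⟩ : Nonempty (ULift.{u} ℕ ⊕ κ.ord.ToType ↪ κ.ord.ToType) := hJ.trans_eq hW.symm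
  -- The elements `z (ι k)` use only the countable index set `S`. Moving `S` into the part with
  -- values in `A`, and the other indices injectively into the rest, is type-preserving and carries
  -- these elements into `A`.
  let h : ULift.{u} ℕ ⊕ κ.ord.ToType → ULift.{u} ℕ ⊕ κ.ord.ToType := fun j =>
    if hj : j ∈ S then Sum.inl (enc ⟨j, hj⟩) else Sum.inr (enc' j)
  have hh : Function.Injective h := by
    intro j j' e
    by_cases hj : j ∈ S <;> by_cases hj' : j' ∈ S <;> simp only [h, hj, hj', dif_pos, dif_neg,
      not_false_eq_true] at e
    · exact congrArg Subtype.val (enc.injective (Sum.inl.inj e))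
    · cases e
    · cases e
    · exact enc'.injective (Sum.inr.inj e)
  have key := atp_comp (hx.atp_dval t (b := (Empty.elim : Empty → M)) (fun p => p.elim)
    (f := f) (f' := f ∘ h) hf
    (fun q q' hq => by
      have h1 := Prod.mk.inj (hf (a₁ := (h q.1, q.2)) (a₂ := (h q'.1, q'.2)) hq)
      exact Prod.ext (hh h1.1) h1.2) hfR (fun j => hfR (h j))) Sum.inr
  obtain ⟨θ, hθ⟩ := exists_equiv_span (x := y) (y := y ∘ h) key
  refine ⟨span L (y ∘ h), fun w => θ (z w), H.univ.span_mem hM _,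
    (Cardinal.mk_congr θ.toEquiv).symm.trans hN₁, hz.equiv θ,
    (atp_map θ.toEmbedding z).trans hzx, fun k => ?_⟩
  have h1 : z (ι k) = ⟨((τ ⟨k⟩).relabel Subtype.val).realize y, realize_mem_span _ _⟩ := by
    refine Subtype.ext ?_
    change (z (ι k) : M) = ((τ ⟨k⟩).relabel Subtype.val).realize y
    rw [Term.realize_relabel]
    exact hτ ⟨k⟩
  have h2 := hθ ((τ ⟨k⟩).relabel Subtype.val)
  rw [← h1, Term.realize_relabel] at h2
  change (θ (z (ι k)) : M) ∈ A
  rw [h2]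
  refine Term.realize_mem _ _ fun j => ?_
  simp only [Function.comp_apply, h, j.2, dif_pos, y, f, Sum.elim_inl]
  exact hsA _

/-- Finitely many elements of an extension are indiscernible from finitely many elements over
a small part of a basis. -/
theorem exists_finset_atp_eq {M : Type u} [L.Structure M] (hM : K M) {N : L.Substructure M}
    (hN : K N) (hN' : #N = κ) {W : Type u} {z : W → N} (hz : IsBasis L z) {I : Set W} (hI : #I < κ)
    {q : ℕ} (b : Fin q → M) : ∃ E : Finset W, ∀ (P : Type) (g g' : P → W), Function.Injective g →
      Function.Injective g' → (∀ p, g p ∈ I ∧ g p ∉ E) → (∀ p, g' p ∈ I ∧ g' p ∉ E) →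
      atp L (Sum.elim b fun p => (z (g p) : M)) = atp L (Sum.elim b fun p => (z (g' p) : M)) := by
  classical
  -- Saturation replaces `b` by a tuple `c` in `N` with the same type over the part `I` of the
  -- basis. The exceptional set consists of the finitely many basis indices used by `c`.
  obtain ⟨c, hc⟩ := H.exists_realization_of_embedding hN hN' hM N.subtype (fun i : I => z i) hI b
  obtain ⟨m, v, t, hv, ht⟩ := exists_common_support (x := z) c fun k => hz.generates _
  refine ⟨Finset.univ.image v, ?_⟩
  have h1 : ∀ {P : Type} {g : P → W} (hg : ∀ p, g p ∈ I),
      atp L (Sum.elim b fun p => (z (g p) : M)) = atp L (Sum.elim c fun p => z (g p)) := by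
    intro P g hg
    have h2 := atp_comp hc.symm (Sum.elim Sum.inr fun p : P => Sum.inl ⟨g p, hg p⟩)
    convert h2 using 2
    · funext s
      rcases s with s | s <;> rfl
    · funext s
      rcases s with s | s <;> rfl
  intro P g g' hg hg' hgE hgE'
  rw [h1 fun p => (hgE p).1, h1 fun p => (hgE' p).1]
  have hinj : ∀ {g : P → W}, Function.Injective g → (∀ p, g p ∉ Finset.univ.image v) →
      Function.Injective (Sum.elim v g) := fun hg h => hv.sumElim hg fun i p e =>
    h p (Finset.mem_image.2 ⟨i, Finset.mem_univ _, e⟩)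
  have h3 := atp_terms (hz.atp_eq (hinj hg fun p => (hgE p).2) (hinj hg' fun p => (hgE' p).2))
    (V := Fin q ⊕ P) (Sum.elim (fun k => (t k).relabel Sum.inl) fun p => Term.var (Sum.inr p))
  have e : ∀ g : P → W, (fun s => (Sum.elim (fun k => (t k).relabel Sum.inl)
      (fun p => Term.var (Sum.inr p)) s : L.Term (Fin m ⊕ P)).realize (z ∘ Sum.elim v g)) =
      Sum.elim c fun p => z (g p) := by
    intro g
    funext s
    rcases s with s | s
    · simp only [Sum.elim_inl, Term.realize_relabel, ht]
      rfl
    · rfl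
  rw [e, e] at h3
  exact h3

end IsCategoricalClass

/-- An independent family `J` whose type over each finite part of `A` is the limit of the types of
the sequence `y` in `A`. -/
structure IsAverage {M : Type u} [L.Structure M] (A : L.Substructure M) (y : ℕ → M) {W : Type u}
    (J : W → M) : Prop where
  injective : Function.Injective J
  mem : ∀ k, y k ∈ A
  exists_bound : ∀ (q : ℕ) (b : Fin q → M), (∀ i, b i ∈ A) → ∃ m : ℕ, ∀ (n : ℕ) (g : Fin n → ℕ)
    (g' : Fin n → W), Function.Injective g → Function.Injective g' → (∀ i, m ≤ g i) →
    atp L (Sum.elim b fun i => y (g i)) = atp L (Sum.elim b fun i => J (g' i))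

namespace IsCategoricalClass

variable {κ : Cardinal.{u}} (H : IsCategoricalClass K κ)

include H

/-- A basis `z` of a submodel has its prescribed part `z ∘ ι` in `A` but κ elements in all, so it
contains infinitely many term values indiscernible over `A`. These link the sequence in `A` to κ
further values of the same term. -/
theorem exists_isAverage {M₀ M : Type u} [L.Structure M₀] [L.Structure M] (hM₀ : K M₀)
    (hM₀' : #M₀ = κ) (hM : K M) (hM' : #M = κ) {x₀ : κ.ord.ToType → M₀} (hx₀ : IsBasis L x₀)
    (A : L.Substructure M) (hA : L.card + ℵ₀ < #A) (hAκ : #A < κ) {ι : ℕ → κ.ord.ToType}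
    (hι : Function.Injective ι) :
    ∃ (y : ℕ → M) (J : κ.ord.ToType → M), IsAverage A y J ∧ atp L y = atp L (x₀ ∘ ι) := by
  classical
  have hW : #κ.ord.ToType = κ := by simp
  obtain ⟨N, z, hN, hN', hz, hzx, hzA⟩ := H.exists_isBasis_mem hM₀ hM₀' hM hM' hx₀ A hA ι
  obtain ⟨x, hx⟩ := H.exists_isBasis hM hM'
  obtain ⟨S, T, hS, hT⟩ := exists_small_support (x := x) (fun a : A => (a : M))
    (fun p => hx.generates _) (le_add_self.trans hA.le) le_rfl
  have hzinj : Function.Injective fun w => (z w : M) := Subtype.val_injective.comp hz.injective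
  obtain ⟨R, n, t, hSR, hR, hd, s, hs, hsR, hsz⟩ := hx.exists_dval
    (X := Set.range fun w => (z w : M)) hA.le (by
      rw [Cardinal.mk_range_eq _ hzinj, hW]
      exact hAκ) hS
  choose ρ hρ using hsz
  have hρinj : Function.Injective ρ := by
    intro k l h
    refine injective_of_tuples (d := dval x t) hs hsR hd ?_
    change dval x t (s k) = dval x t (s l)
    rw [← hρ, ← hρ, h]
  obtain ⟨f, hf, hfR⟩ := H.exists_tuples (hR.trans_lt hAκ) (J := κ.ord.ToType) hW.le n
  refine ⟨fun k => z (ι k), fun w => dval x t (f w),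
    ⟨injective_of_tuples (d := dval x t) hf hfR hd, hzA, fun q b hb => ?_⟩, ?_⟩
  · have hbR : ∀ p, b p ∈ span L (fun r : R => x r) := by
      intro p
      refine ⟨(T ⟨b p, hb p⟩).relabel (Set.inclusion hSR), ?_⟩
      simp only [Term.realize_relabel]
      exact (hT ⟨b p, hb p⟩).symm
    -- Off `E`, the basis elements indexed by `ι` and by `ρ` have the same types over `b`. The
    -- latter are term values, which may be exchanged for members of `J` over the support of `A`.
    obtain ⟨E, hE⟩ := H.exists_finset_atp_eq hM hN hN' hz (I := Set.range ι ∪ Set.range ρ)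
      (lt_of_le_of_lt (Cardinal.mk_le_aleph0_iff.2
        ((Set.countable_range ι).union (Set.countable_range ρ))) H.aleph0_lt) b
    have hbound : ∀ {σ : ℕ → κ.ord.ToType}, Function.Injective σ → ∃ m, ∀ k, m ≤ k → σ k ∉ E := by
      intro σ hσ
      obtain ⟨m, hm⟩ := (E.finite_toSet.preimage hσ.injOn).bddAbove
      exact ⟨m + 1, fun k hk hkE => absurd (hm hkE) (by omega)⟩
    obtain ⟨m, hm⟩ := hbound hι
    obtain ⟨m', hm'⟩ := hbound hρinj
    refine ⟨m, fun n' g g' hg hg' hgm => ?_⟩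
    have h1 := hE (Fin n') (ι ∘ g) (fun i => ρ (m' + i)) (hι.comp hg)
      (fun i j h => Fin.ext (Nat.add_left_cancel (hρinj h)))
      (fun i => ⟨Or.inl ⟨_, rfl⟩, hm _ (hgm i)⟩)
      (fun i => ⟨Or.inr ⟨_, rfl⟩, hm' _ (Nat.le_add_right _ _)⟩)
    refine h1.trans ?_
    simp only [hρ]
    refine hx.atp_dval t hbR (f := fun i : Fin n' => s (m' + i)) (f' := fun i => f (g' i)) ?_ ?_
      (fun i => hsR _) (fun i => hfR _)
    · intro p p' h
      have h2 := Prod.mk.inj (hs (a₁ := (m' + p.1, p.2)) (a₂ := (m' + p'.1, p'.2)) h)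
      exact Prod.ext (Fin.ext (Nat.add_left_cancel h2.1)) h2.2
    · intro p p' h
      have h2 := Prod.mk.inj (hf (a₁ := (g' p.1, p.2)) (a₂ := (g' p'.1, p'.2)) h)
      exact Prod.ext (hg' h2.1) h2.2
  · exact (atp_coe (z ∘ ι)).trans (atp_comp hzx ι)

end IsCategoricalClass

/-- Averages of corresponding sequences have the same type over corresponding sets. -/
theorem IsAverage.atp_eq {M M' : Type u} [L.Structure M] [L.Structure M'] {A : L.Substructure M}
    {A' : L.Substructure M'} {y : ℕ → M} {y' : ℕ → M'} {W : Type u} {J : W → M} {J' : W → M'}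
    (h : IsAverage A y J) (h' : IsAverage A' y' J') {β : Type u} {b : β → M} {b' : β → M'}
    (hb : ∀ p, b p ∈ A) (hb' : ∀ p, b' p ∈ A') (hbb : atp L b = atp L b') {j : ℕ → β}
    (hj : ∀ k, b (j k) = y k) (hj' : ∀ k, b' (j k) = y' k) :
    atp L (Sum.elim b J) = atp L (Sum.elim b' J') := by
  classical
  refine atp_eq_of_finite fun G => ?_
  let q := G.toLeft.card
  let n := G.toRight.card
  let v : Fin q → β := fun i => G.toLeft.equivFin.symm i
  let w : Fin n → W := fun i => G.toRight.equivFin.symm i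
  have hw : Function.Injective w := Subtype.val_injective.comp (Equiv.injective _)
  obtain ⟨m, hm⟩ := h.exists_bound q (b ∘ v) fun i => hb _
  obtain ⟨m', hm'⟩ := h'.exists_bound q (b' ∘ v) fun i => hb' _
  let g : Fin n → ℕ := fun i => max m m' + i
  have hg : Function.Injective g := fun i i' e => Fin.ext (Nat.add_left_cancel e)
  have h1 := hm n g w hg hw fun i => (le_max_left _ _).trans (Nat.le_add_right _ _)
  have h2 := hm' n g w hg hw fun i => (le_max_right _ _).trans (Nat.le_add_right _ _)
  have h3 := atp_comp hbb (Sum.elim v fun i => j (g i))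
  have e1 : b ∘ (Sum.elim v fun i => j (g i)) = Sum.elim (b ∘ v) fun i => y (g i) := by
    funext z
    rcases z with z | z
    · rfl
    · exact hj _
  have e2 : b' ∘ (Sum.elim v fun i => j (g i)) = Sum.elim (b' ∘ v) fun i => y' (g i) := by
    funext z
    rcases z with z | z
    · rfl
    · exact hj' _
  rw [e1, e2] at h3
  have h4 := atp_comp (h1.symm.trans (h3.trans h2)) (fun s : G => match s with
    | ⟨Sum.inl p, hp⟩ => Sum.inl (G.toLeft.equivFin ⟨p, Finset.mem_toLeft.2 hp⟩)
    | ⟨Sum.inr p, hp⟩ => Sum.inr (G.toRight.equivFin ⟨p, Finset.mem_toRight.2 hp⟩))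
  convert h4 using 2
  · funext s
    rcases s with ⟨s | s, hs⟩ <;> simp [v, w]
  · funext s
    rcases s with ⟨s | s, hs⟩ <;> simp [v, w]

/-! ### Back-and-forth between substructures -/

namespace IsCategoricalClass

variable {κ : Cardinal.{u}} (H : IsCategoricalClass K κ)

include H

/-- The extension property of the back-and-forth argument. -/
theorem exists_extension {M M' : Type u} [L.Structure M] [L.Structure M'] (hM : K M) (hM' : K M')
    (hMκ' : #M' = κ) {A : L.Substructure M} {A' : L.Substructure M'}
    {y : ℕ → M} {y' : ℕ → M'} {J : κ.ord.ToType → M} {J' : κ.ord.ToType → M'}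
    (h : IsAverage A y J) (h' : IsAverage A' y' J') (hA' : L.card + ℵ₀ < #A') {β : Type u}
    {b : β → M} {b' : β → M'} (hβ : #β < #A') (hb : ∀ p, b p ∈ A) (hb' : ∀ p, b' p ∈ A')
    (hbb : atp L b = atp L b') {j : ℕ → β} (hj : ∀ k, b (j k) = y k) (hj' : ∀ k, b' (j k) = y' k)
    (a : M) : ∃ a' ∈ A', atp L (Sum.elim b fun _ : Fin 1 => a) =
      atp L (Sum.elim b' fun _ : Fin 1 => a') := by
  have hW : #κ.ord.ToType = κ := by simp
  have : Nonempty κ.ord.ToType := Cardinal.nonempty_ord_toType H.reg.pos.ne'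
  have hβκ : #β < κ := hβ.trans_le ((Cardinal.mk_subtype_le _).trans hMκ'.le)
  -- Adjoining the averages keeps the types equal and enlarges the spans to size κ, so that
  -- saturation of models of size κ applies and gives a match for `a` in the span of `b'` and `J'`.
  obtain ⟨θ, hθ⟩ := exists_equiv_span (h.atp_eq h' hb hb' hbb hj hj').symm
  have hN : #(span L (Sum.elim b' J')) = κ := H.mk_span_eq _
    (mk_sum_le H.aleph0_le hβκ.le hW.le) hW (g := Sum.inr) h'.injective
  obtain ⟨c, hc⟩ := H.exists_realization_of_embedding (H.univ.span_mem hM' _) hN hM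
    ((span L (Sum.elim b J)).subtype.comp θ.toEmbedding)
    (fun p : β => toSpan L (Sum.elim b' J') (Sum.inl p)) hβκ fun _ : Fin 1 => a
  have h1 : ∀ p, ((span L (Sum.elim b J)).subtype.comp θ.toEmbedding)
      (toSpan L (Sum.elim b' J') (Sum.inl p)) = b p := fun p => hθ (Term.var (Sum.inl p))
  simp only [h1] at hc
  rw [← atp_coe] at hc
  -- The match `c` may lie outside `A'`; saturation of `A'` moves it inside.
  obtain ⟨a', ha', h2⟩ := H.exists_realization_mem hM' hMκ' A' (χ := max (L.card + ℵ₀) #β)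
    (le_max_left _ _) (max_lt hA' hβ) b' hb' (le_max_right _ _) fun i => (c i : M')
  refine ⟨a', ha', hc.symm.trans (Eq.trans ?_ h2.symm)⟩
  congr 1
  funext z
  rcases z with z | z <;> rfl

end IsCategoricalClass

/-- Types of families that are extended one element at a time agree. -/
theorem atp_eq_of_stages {C T : Type*} {M M' : Type u} [L.Structure M] [L.Structure M'] [LinearOrder T]
    {y : C → M} {y' : C → M'} {f : T → M} {f' : T → M'} (hy : atp L y = atp L y') (I : Set T)
    (h : ∀ i ∈ I, atp L (Sum.elim (Sum.elim y fun j : Set.Iio i => f j) fun _ : Fin 1 => f i) =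
      atp L (Sum.elim (Sum.elim y' fun j : Set.Iio i => f' j) fun _ : Fin 1 => f' i)) :
    atp L (Sum.elim y fun j : I => f j) = atp L (Sum.elim y' fun j : I => f' j) := by
  classical
  refine atp_eq_of_finite fun G => ?_
  rcases G.toRight.eq_empty_or_nonempty with hG | hG
  · have hno : ∀ j : I, Sum.inr j ∉ G := fun j hj => by
      have := Finset.mem_toRight.2 hj
      rw [hG] at this
      exact absurd this (Finset.notMem_empty _)
    have h1 := atp_comp hy (fun s : G => match s with
      | ⟨Sum.inl p, _⟩ => p
      | ⟨Sum.inr p, hp⟩ => absurd hp (hno p))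
    convert h1 using 2
    · funext s
      rcases s with ⟨s | s, hs⟩
      · rfl
      · exact absurd hs (hno s)
    · funext s
      rcases s with ⟨s | s, hs⟩
      · rfl
      · exact absurd hs (hno s)
  · let i := G.toRight.max' hG
    have hle : ∀ j : I, Sum.inr j ∈ G → j ≤ i := fun j hj =>
      Finset.le_max' _ _ (Finset.mem_toRight.2 hj)
    have h1 := atp_comp (h i i.2) (fun s : G => match s with
      | ⟨Sum.inl p, _⟩ => Sum.inl (Sum.inl p)
      | ⟨Sum.inr p, _⟩ => if hp : (p : T) < i then Sum.inl (Sum.inr ⟨p, hp⟩) else Sum.inr 0)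
    convert h1 using 2
    · funext s
      rcases s with ⟨s | s, hs⟩
      · rfl
      · by_cases hp : (s : T) < i
        · simp [Subtype.coe_lt_coe.1 hp]
        · have : s = i := le_antisymm (hle s hs) (not_lt.1 hp)
          simp [this]
    · funext s
      rcases s with ⟨s | s, hs⟩
      · rfl
      · by_cases hp : (s : T) < i
        · simp [Subtype.coe_lt_coe.1 hp]
        · have : s = i := le_antisymm (hle s hs) (not_lt.1 hp)
          simp [this]

/-- A transfinite back-and-forth construction. -/
theorem exists_equiv_of_extension {M M' : Type u} [L.Structure M] [L.Structure M']
    {A : L.Substructure M} {A' : L.Substructure M'} {μ : Cardinal.{u}} (hμ : ℵ₀ < μ) (hA : #A = μ)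
    (hA' : #A' = μ) {y : ULift.{u} ℕ → M} {y' : ULift.{u} ℕ → M'} (hyA : ∀ k, y k ∈ A)
    (hyA' : ∀ k, y' k ∈ A') (hy : atp L y = atp L y')
    (ext : ∀ (β : Type u) (b : β → M) (b' : β → M'), #β < μ → (∀ p, b p ∈ A) → (∀ p, b' p ∈ A') →
      atp L b = atp L b' → (∃ j : ℕ → β, ∀ k, b (j k) = y ⟨k⟩ ∧ b' (j k) = y' ⟨k⟩) →
      (∀ a ∈ A, ∃ a' ∈ A', atp L (Sum.elim b fun _ : Fin 1 => a) =
        atp L (Sum.elim b' fun _ : Fin 1 => a')) ∧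
      ∀ a' ∈ A', ∃ a ∈ A, atp L (Sum.elim b fun _ : Fin 1 => a) =
        atp L (Sum.elim b' fun _ : Fin 1 => a')) : Nonempty (A ≃[L] A') := by
  classical
  let T := μ.ord.ToType
  have hT : #T = μ := by simp [T]
  obtain ⟨h⟩ : Nonempty (T ≃ A ⊕ A') := by
    -- Each stage handles one element of one side, and both sides have size `μ`, so `μ` stages
    -- exhaust them.
    refine Cardinal.eq.1 ?_
    rw [Cardinal.mk_sum, Cardinal.lift_id, Cardinal.lift_id, hA, hA', hT,
      Cardinal.add_eq_self hμ.le]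
  let Step : ∀ i : T, (Set.Iio i → A × A') → A × A' → Prop := fun i D q =>
    atp L (Sum.elim (Sum.elim y fun j => ((D j).1 : M)) fun _ : Fin 1 => (q.1 : M)) =
      atp L (Sum.elim (Sum.elim y' fun j => ((D j).2 : M')) fun _ : Fin 1 => (q.2 : M')) ∧
    (∀ a, h i = Sum.inl a → q.1 = a) ∧ ∀ a, h i = Sum.inr a → q.2 = a
  have hStep : ∀ i D, atp L (Sum.elim y fun j => ((D j).1 : M)) =
      atp L (Sum.elim y' fun j => ((D j).2 : M')) → ∃ q, Step i D q := by
    intro i D hD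
    obtain ⟨h1, h2⟩ := ext (ULift.{u} ℕ ⊕ Set.Iio i) _ _ (by
      rw [Cardinal.mk_sum, Cardinal.lift_id, Cardinal.lift_id]
      exact Cardinal.add_lt_of_lt hμ.le (by simpa using hμ) (mk_Iio_lt i))
      (by rintro (k | k); exacts [hyA k, (D k).1.2])
      (by rintro (k | k); exacts [hyA' k, (D k).2.2]) hD
      ⟨fun k => Sum.inl ⟨k⟩, fun k => ⟨rfl, rfl⟩⟩
    rcases hi : h i with a | a
    · obtain ⟨a', ha', h3⟩ := h1 a a.2
      exact ⟨(a, ⟨a', ha'⟩), h3, fun c hc => Sum.inl.inj (hi.symm.trans hc),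
        fun c hc => absurd (hi.symm.trans hc) (by simp)⟩
    · obtain ⟨a', ha', h3⟩ := h2 a a.2
      exact ⟨(⟨a', ha'⟩, a), h3, fun c hc => absurd (hi.symm.trans hc) (by simp),
        fun c hc => Sum.inr.inj (hi.symm.trans hc)⟩
  let P : T → A × A' := wellFounded_lt.fix fun i rec =>
    if h : ∃ q, Step i (fun j => rec j j.2) q then h.choose else (⟨y ⟨0⟩, hyA _⟩, ⟨y' ⟨0⟩, hyA' _⟩)
  have hP : ∀ i, (∃ q, Step i (fun j => P j) q) → Step i (fun j => P j) (P i) := by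
    intro i h
    have e : P i = h.choose := by
      conv_lhs => rw [show P = wellFounded_lt.fix _ from rfl, WellFounded.fix_eq]
      exact dif_pos h
    rw [e]
    exact h.choose_spec
  have hst : ∀ i, Step i (fun j => P j) (P i) := by
    intro i
    induction i using WellFoundedLT.induction with
    | ind i ih =>
    exact hP i (hStep _ _ (atp_eq_of_stages (f := fun i => ((P i).1 : M))
      (f' := fun i => ((P i).2 : M')) hy (Set.Iio i) fun j hj => (ih j hj).1))
  have hall := atp_comp (atp_eq_of_stages (f := fun i => ((P i).1 : M))
      (f' := fun i => ((P i).2 : M')) hy Set.univ fun j _ => (hst j).1)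
      fun i : T => Sum.inr ⟨i, Set.mem_univ i⟩
  have h1 : atp L (fun i => (P i).1) = atp L fun i => (P i).2 :=
    (atp_coe _).symm.trans (hall.trans (atp_coe _))
  obtain ⟨θ, -⟩ := exists_equiv_of_atp_eq
    (generates_of_surjective fun a => ⟨h.symm (Sum.inl a), (hst _).2.1 a (by simp)⟩)
    (generates_of_surjective fun a => ⟨h.symm (Sum.inr a), (hst _).2.2 a (by simp)⟩) h1
  exact ⟨θ⟩

namespace IsCategoricalClass

variable {κ : Cardinal.{u}} (H : IsCategoricalClass K κ)

include H

/-- Substructures of models of cardinality `κ` are determined by their cardinality. -/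
theorem exists_equiv_substructure {M M' : Type u} [L.Structure M] [L.Structure M'] (hM : K M)
    (hMκ : #M = κ) (hM' : K M') (hMκ' : #M' = κ) (A : L.Substructure M) (A' : L.Substructure M')
    {μ : Cardinal.{u}} (hμ : L.card + ℵ₀ < μ) (hμκ : μ < κ) (hA : #A = μ) (hA' : #A' = μ) :
    Nonempty (A ≃[L] A') := by
  obtain ⟨x₀, hx₀⟩ := H.exists_isBasis hM hMκ
  have : Infinite κ.ord.ToType := Cardinal.infinite_iff.2 (by simpa using H.aleph0_le)
  let ι := Infinite.natEmbedding κ.ord.ToType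
  obtain ⟨y, J, hJ, hy⟩ := H.exists_isAverage hM hMκ hM hMκ hx₀ A (hμ.trans_eq hA.symm)
    (hA.trans_lt hμκ) ι.injective
  obtain ⟨y', J', hJ', hy'⟩ := H.exists_isAverage hM hMκ hM' hMκ' hx₀ A' (hμ.trans_eq hA'.symm)
    (hA'.trans_lt hμκ) ι.injective
  refine exists_equiv_of_extension (lt_of_le_of_lt le_add_self hμ) hA hA' (y := fun k => y k.down)
    (y' := fun k => y' k.down) (fun k => hJ.mem _) (fun k => hJ'.mem _)
    (atp_comp (hy.trans hy'.symm) ULift.down) ?_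
  rintro β b b' hβ hb hb' hbb ⟨j, hj⟩
  constructor
  · intro a _
    exact H.exists_extension hM hM' hMκ' hJ hJ' (hμ.trans_eq hA'.symm) (hβ.trans_eq hA'.symm)
      hb hb' hbb (fun k => (hj k).1) (fun k => (hj k).2) a
  · intro a _
    obtain ⟨a', ha', h⟩ := H.exists_extension hM' hM hMκ hJ' hJ (hμ.trans_eq hA.symm)
      (hβ.trans_eq hA.symm) hb' hb hbb.symm (fun k => (hj k).2) (fun k => (hj k).1) a
    exact ⟨a', ha', h.symm⟩

end IsCategoricalClass

/-! ### Reduction to substructures of models of cardinality κ -/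

namespace IsCategoricalClass

variable {κ : Cardinal.{u}} (H : IsCategoricalClass K κ)

include H

theorem exists_span_of_subset {B : Type u} [L.Structure B] (hB : K B) {X : Set B} (hX : X.Nonempty)
    {μ : Cardinal.{u}} (hμ : L.card + ℵ₀ ≤ μ) (hXμ : #X ≤ μ) (hμB : μ ≤ #B) :
    ∃ M : L.Substructure B, K M ∧ #M = μ ∧ X ⊆ M := by
  have hμ₀ : ℵ₀ ≤ μ := le_add_self.trans hμ
  obtain ⟨Y, hY⟩ := Cardinal.le_mk_iff_exists_set.1 hμB
  have : Nonempty (X ∪ Y : Set B) := (hX.mono Set.subset_union_left).to_subtype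
  let x : (X ∪ Y : Set B) → B := Subtype.val
  refine ⟨span L x, H.univ.span_mem hB x, le_antisymm ?_ ?_, fun a ha =>
    apply_mem_span x ⟨a, Or.inl ha⟩⟩
  · refine (card_span_le x).trans ((add_le_add ((Cardinal.mk_union_le _ _).trans
      (add_le_add hXμ hY.le)) hμ).trans ?_)
    rw [Cardinal.add_eq_self hμ₀, Cardinal.add_eq_self hμ₀]
  · rw [← hY]
    exact Cardinal.mk_le_mk_of_subset fun a ha => apply_mem_span x ⟨a, Or.inr ha⟩

/-- Models that embed into large models embed into models of cardinality `κ`. -/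
theorem exists_embedding_of_star {lam : Cardinal.{u}} {A : Type u} [L.Structure A]
    (hA : Star K lam κ A) (hAκ : #A ≤ κ) :
    ∃ (M : Type u) (_ : L.Structure M), K M ∧ #M = κ ∧ Nonempty (A ↪[L] M) := by
  obtain ⟨-, hlt, B, _, hB, hκB, ⟨e⟩⟩ := hA
  have : Nonempty A := Cardinal.mk_ne_zero_iff.1 (pos_of_gt hlt).ne'
  obtain ⟨M, hM, hMκ, hsub⟩ := H.exists_span_of_subset hB (X := Set.range e)
    (Set.range_nonempty e) H.lt.le (Cardinal.mk_range_le.trans hAκ) hκB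
  exact ⟨M, inferInstance, hM, hMκ, ⟨⟨⟨fun a => ⟨e a, hsub ⟨a, rfl⟩⟩,
    fun a b h => e.injective (congrArg Subtype.val h)⟩,
    fun f x => Subtype.ext (e.map_fun f x), fun r x => e.map_rel r x⟩⟩⟩

theorem isCategoricalIn_star {μ : Cardinal.{u}} (hμ : L.card + ℵ₀ < μ) (hμκ : μ ≤ κ) :
    IsCategoricalIn (Star K (L.card + ℵ₀) κ) μ := by
  obtain ⟨M₀, _, hM₀, hM₀'⟩ := H.cat.1
  have : Nonempty M₀ := Cardinal.mk_ne_zero_iff.1 (hM₀' ▸ H.reg.pos.ne')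
  constructor
  · obtain ⟨A, hA, hAμ, -⟩ := H.exists_span_of_subset hM₀ (X := {Classical.arbitrary M₀})
      (Set.singleton_nonempty _) hμ.le (by
        rw [Cardinal.mk_singleton]
        exact Cardinal.one_le_aleph0.trans (le_add_self.trans hμ.le)) (hμκ.trans_eq hM₀'.symm)
    exact ⟨A, inferInstance, ⟨hA, hμ.trans_eq hAμ.symm, M₀, inferInstance, hM₀, hM₀'.ge,
      ⟨A.subtype⟩⟩, hAμ⟩
  · intro A A' _ _ hA hA' hAμ hAμ'
    rcases hμκ.eq_or_lt with rfl | hlt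
    · exact H.cat.2 A A' hA.1 hA'.1 hAμ hAμ'
    · obtain ⟨M, _, hM, hMκ, ⟨e⟩⟩ := H.exists_embedding_of_star hA (hAμ.trans_le hμκ)
      obtain ⟨M', _, hM', hMκ', ⟨e'⟩⟩ := H.exists_embedding_of_star hA' (hAμ'.trans_le hμκ)
      obtain ⟨θ⟩ := H.exists_equiv_substructure hM hMκ hM' hMκ' e.toHom.range e'.toHom.range hμ hlt
        ((Cardinal.mk_congr e.equivRange.toEquiv).symm.trans hAμ)
        ((Cardinal.mk_congr e'.equivRange.toEquiv).symm.trans hAμ')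
      exact ⟨e'.equivRange.symm.comp (θ.comp e.equivRange)⟩

end IsCategoricalClass

end UniversalClasses

theorem mainTheorem8 (L : FirstOrder.Language.{u, u}) (K : UniversalClasses.ModelClass L)
    (lam κ : Cardinal.{u})
    (hK : UniversalClasses.IsUniversalClass K)
    (hlarge : UniversalClasses.HasArbitrarilyLargeModels K)
    (hLS : UniversalClasses.LS K = lam)
    (hlam : lam = L.card + ℵ₀)
    (hκreg : κ.IsRegular)
    (hκ : Order.succ lam < κ)
    (hcat : UniversalClasses.IsCategoricalIn K κ)
    (μ : Cardinal.{u}) (hμ : Order.succ lam < μ) (hμκ : μ ≤ κ) :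
    UniversalClasses.IsCategoricalIn (UniversalClasses.Star K lam κ) μ := by
  subst hlam
  exact UniversalClasses.IsCategoricalClass.isCategoricalIn_star
    ⟨hK, hlarge, (Order.lt_succ _).trans hκ, hκreg, hcat⟩ ((Order.lt_succ _).trans hμ) hμκ
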